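/- Let $k\ge 1$ and let $\Lambda$ be a row-finite $k$-graph without sources: a countable small category $\Lambda$ with object set $\Lambda^0$, range and source maps $r,s$, and a degree functor $d:\Lambda\to\mathbb{N}^k$ such that every $\lambda$ with $d(\lambda)=m+n$ factors uniquely as $\lambda=\mu_1\mu_2$ with $d(\mu_1)=m$, $d(\mu_2)=n$; moreover $v\Lambda^n:=\{\lambda : r(\lambda)=v,\ d(\lambda)=n\}$ is finite and nonempty for all $v\in\Lambda^0$, $n\in\mathbb{N}^k$. Let $\mathsf{k}$ be any field and let $\operatorname{KP}_{\mathsf k}(\Lambda)$ be the Kumjian–Pask algebra, i.e. the (not necessarily unital) $\mathsf{k}$-algebra generated by a universal Kumjian–Pask $\Lambda$-family $p_v$, $s_\lambda$, $s_{\lambda^*}$. For $H\subseteq\Lambda^0$ let $I(H)$ denote the two-sided ideal of $\operatorname{KP}_{\mathsf k}(\Lambda)$ generated by $\{p_v : v\in H\}$. Let $T_\Lambda$ be the talented monoid of $\Lambda$: the commutative monoid generated by the symbols $v(n)$ ($v\in\Lambda^0$, $n\in\mathbb{Z}^k$) subject to $$v(n)=\sum_{\alpha\in v\Lambda^{e_i}}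 s(\alpha)(n+e_i)\qquad (v\in\Lambda^0,\ n\in\mathbb{Z}^k,\ 1\le i\le k),$$ with the algebraic pre-order ($x\le y$ iff $y=x+z$ for some $z$) and the $\mathbb{Z}^k$-action ${}^{n}v(m)=v(m+n)$; write $v$ for $v(0)$. An atom is a nonunit $a\in T_\Lambda$ such that $a=b+c$ implies that $b$ or $c$ is a unit. A nonzero element $a$ is aperiodic if ${}^{n}a=a$ only for $n=0$. A $\mathbb{Z}^k$-order ideal is a submonoid that is downward closed for $\le$ and closed under the $\mathbb{Z}^k$-action. Let $\mathcal{A}$ be the $\mathbb{Z}^k$-order ideal of $T_\Lambda$ generated by all aperiodic atoms, and let $H_{\mathcal{A}}=\{v\in\Lambda^0 : v(0)\in\mathcal{A}\}$. Then the following hold. (i) For $v\in\Lambda^0$, $\operatorname{KP}_{\mathsf k}(\Lambda)p_v$ is a minimal left ideal of $\operatorname{KP}_{\mathsf k}(\Lambda)$ if and only if $v$ is an aperiodic atom in $T_\Lambda$. (ii) $\operatorname{Soc}(\operatorname{KP}_{\mathsf k}(\Lambda))=I(H_{\mathcal{A}})$, where the socle is the sum of all minimal left ideals. (iii) $\operatorname{Soc}(\operatorname{KP}_{\mathsf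 k}(\Lambda))$ is an essential ideal of $\operatorname{KP}_{\mathsf k}(\Lambda)$ (a two-sided ideal having nonzero intersection with every nonzero two-sided ideal) if and only if for each $v\in\Lambda^0$ there exist $w\in\Lambda^0$ and $m\in\mathbb{N}^k$ such that $v\ge w(m)$ and $w(m)$ is an aperiodic atom in $T_\Lambda$. -/

import Mathlib

open CategoryTheory

universe u w x

/-- A `k`-graph whose underlying category is `V`: a countable category with a degree functor to
`ℕ^k` that has the unique factorization property.  A morphism `f : a ⟶ b` is a path with source
`s(f) = a` and range `r(f) = b`, so that the product `λμ` of paths with `s(λ) = r(μ)` is the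
categorical composite `λ ∘ μ`, which Mathlib writes `μ ≫ λ`. -/
structure HigherRankGraph (k : ℕ) (V : Type u) [Category.{w} V] where
  /-- The degree of a path. -/
  deg : ∀ {a b : V}, (a ⟶ b) → (Fin k → ℕ)
  countable_vertices : Countable V
  countable_paths : Countable (Arrow V)
  deg_id : ∀ a : V, deg (𝟙 a) = 0
  deg_comp : ∀ {a b c : V} (mu : a ⟶ b) (la : b ⟶ c), deg (mu ≫ la) = deg la + deg mu
  /-- If `d(λ) = m + n` then `λ = μ₁ μ₂` for unique `μ₁`, `μ₂` of degrees `m`, `n`. Here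
  `p = ⟨c, μ₂, μ₁⟩`, where `c = s(μ₁) = r(μ₂)`. -/
  factorization : ∀ {a b : V} (la : a ⟶ b) (m n : Fin k → ℕ), deg la = m + n →
    ∃! p : (Σ c : V, (a ⟶ c) × (c ⟶ b)), p.2.1 ≫ p.2.2 = la ∧ deg p.2.2 = m ∧ deg p.2.1 = n

namespace HigherRankGraph

variable {k : ℕ} {V : Type u} [Category.{w} V]

/-- The set `vΛⁿ` of paths with range `v` and degree `n`. -/
def PathsInto (G : HigherRankGraph k V) (v : V) (n : Fin k → ℕ) : Type (max u w) :=
  {f : (Σ a : V, (a ⟶ v)) // G.deg f.2 = n}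

/-- The source of a path in `vΛⁿ`. -/
def PathsInto.source {G : HigherRankGraph k V} {v : V} {n : Fin k → ℕ}
    (f : G.PathsInto v n) : V := f.1.1

/-- The path in `vΛⁿ` as a morphism. -/
def PathsInto.hom {G : HigherRankGraph k V} {v : V} {n : Fin k → ℕ}
    (f : G.PathsInto v n) : f.source ⟶ v := f.1.2

/-- Row-finiteness: every `vΛⁿ` is finite. -/
class RowFinite (G : HigherRankGraph k V) : Prop where
  finite_pathsInto : ∀ (v : V) (n : Fin k → ℕ), Finite (G.PathsInto v n)

/-- No sources: every `vΛⁿ` is nonempty. -/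
class NoSources (G : HigherRankGraph k V) : Prop where
  nonempty_pathsInto : ∀ (v : V) (n : Fin k → ℕ), Nonempty (G.PathsInto v n)

noncomputable instance instFintypePathsInto (G : HigherRankGraph k V) [hG : G.RowFinite]
    (v : V) (n : Fin k → ℕ) : Fintype (G.PathsInto v n) :=
  @Fintype.ofFinite _ (hG.finite_pathsInto v n)

/-! ### The talented monoid -/

section Talented

variable (G : HigherRankGraph k V) [G.RowFinite]

/-- The defining relations `v(n) = ∑_{α ∈ vΛ^{e_i}} s(α)(n + e_i)`, for `vΛ^{e_i} ≠ ∅`, on the free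
commutative monoid on the symbols `v(n)`. -/
inductive TalentedRel :
    Multiset (V × (Fin k → ℤ)) → Multiset (V × (Fin k → ℤ)) → Prop
  | mk (v : V) (n : Fin k → ℤ) (i : Fin k) (h : Nonempty (G.PathsInto v (Pi.single i 1))) :
      TalentedRel {(v, n)}
        (∑ α : G.PathsInto v (Pi.single i 1), {(α.source, n + Pi.single i 1)})

/-- The congruence generated by the defining relations. -/
def talentedCon : AddCon (Multiset (V × (Fin k → ℤ))) := addConGen G.TalentedRel

/-- The talented monoid `T_Λ`. -/
abbrev TalentedMonoid : Type u := G.talentedCon.Quotient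

/-- The element `v(n)` of the talented monoid. -/
def state (v : V) (n : Fin k → ℤ) : G.TalentedMonoid := G.talentedCon.mk' {(v, n)}

/-- The shift of states on the free commutative monoid. -/
def freeShift (n : Fin k → ℤ) :
    Multiset (V × (Fin k → ℤ)) →+ Multiset (V × (Fin k → ℤ)) :=
  Multiset.mapAddMonoidHom (fun p => (p.1, p.2 + n))

theorem talentedCon_le_ker_shift (n : Fin k → ℤ) :
    G.talentedCon ≤ AddCon.ker (G.talentedCon.mk'.comp (freeShift (V := V) n)) := by
  refine AddCon.addConGen_le.2 ?_
  rintro _ _ ⟨v, m, i, h⟩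
  rw [AddCon.ker_rel]
  simp only [AddMonoidHom.comp_apply, map_sum]
  have h1 : ∀ p : V × (Fin k → ℤ), freeShift (V := V) n {p} = {(p.1, p.2 + n)} := fun p => rfl
  simp only [h1]
  have h2 := (AddCon.eq G.talentedCon).2
    (AddCon.le_addConGen _ _ (TalentedRel.mk (G := G) v (m + n) i h))
  simp only [add_right_comm m n] at h2
  have h3 := map_sum G.talentedCon.mk'
    (fun α : G.PathsInto v (Pi.single i 1) =>
      ({(α.source, m + Pi.single i 1 + n)} : Multiset (V × (Fin k → ℤ)))) Finset.univ
  exact h2.trans h3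

/-- The action `ⁿx` of `n ∈ ℤ^k` on `x ∈ T_Λ`, given on generators by `ⁿv(m) = v(m + n)`. -/
def shift (n : Fin k → ℤ) : G.TalentedMonoid →+ G.TalentedMonoid :=
  G.talentedCon.lift (G.talentedCon.mk'.comp (freeShift n)) (G.talentedCon_le_ker_shift n)

theorem shift_state (n m : Fin k → ℤ) (v : V) :
    G.shift n (G.state v m) = G.state v (m + n) := rfl

variable {G}

/-- The algebraic pre-order `x ≤ y` on the talented monoid. -/
def AlgLE (a b : G.TalentedMonoid) : Prop := ∃ c : G.TalentedMonoid, b = a + c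

/-- A nonzero element that is fixed by no nonzero `n ∈ ℤ^k`. -/
def IsAperiodicElement (a : G.TalentedMonoid) : Prop :=
  a ≠ 0 ∧ ∀ n : Fin k → ℤ, G.shift n a = a → n = 0

/-- An atom is a nonunit such that in every decomposition `a = b + c`, `b` or `c` is a unit
(this is `AddIrreducible`). -/
def IsAperiodicAtom (a : G.TalentedMonoid) : Prop :=
  AddIrreducible a ∧ IsAperiodicElement a

/-- `ℤ^k`-order ideals: submonoids that are downward closed in the algebraic pre-order and closed
under the action of `ℤ^k`. -/
structure IsOrderIdeal (J : AddSubmonoid G.TalentedMonoid) : Prop where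
  mem_of_le : ∀ a b : G.TalentedMonoid, AlgLE a b → b ∈ J → a ∈ J
  shift_mem : ∀ (n : Fin k → ℤ) (a : G.TalentedMonoid), a ∈ J → G.shift n a ∈ J

/-- The `ℤ^k`-order ideal generated by a set: the intersection of all those that contain it. -/
def orderIdealSpan (S : Set G.TalentedMonoid) : AddSubmonoid G.TalentedMonoid :=
  sInf {J | IsOrderIdeal J ∧ S ⊆ J}

/-- The set of vertices `H_J = {v | v(0) ∈ J}`. -/
def vertexSet (J : AddSubmonoid G.TalentedMonoid) : Set V := {v | G.state v 0 ∈ J}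

end Talented

/-! ### The Kumjian-Pask algebra -/

section KumjianPask

variable (G : HigherRankGraph k V) [G.RowFinite]

/-- A Kumjian-Pask family in a (not necessarily unital) algebra: the elements `P v`, `S λ` and
`Sg λ` (for the ghost path `λ*`). As usual `S` and `Sg` are extended to the paths of degree `0`,
that is, to the vertices, by `S v = Sg v = P v`; with that convention the relations below for all
paths amount to those for paths of nonzero degree. -/
structure IsKPFamily {A : Type x} [NonUnitalRing A] (P : V → A)
    (S Sg : ∀ {a b : V}, (a ⟶ b) → A) : Prop where
  S_id : ∀ v : V, S (𝟙 v) = P v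
  Sg_id : ∀ v : V, Sg (𝟙 v) = P v
  kp1_self : ∀ v : V, P v * P v = P v
  kp1_ne : ∀ v v' : V, v ≠ v' → P v * P v' = 0
  kp2_path : ∀ {a b c : V} (mu : a ⟶ b) (la : b ⟶ c), S la * S mu = S (mu ≫ la)
  kp2_ghost : ∀ {a b c : V} (mu : a ⟶ b) (la : b ⟶ c), Sg mu * Sg la = Sg (mu ≫ la)
  kp2_range_path : ∀ {a b : V} (la : a ⟶ b), P b * S la = S la
  kp2_path_source : ∀ {a b : V} (la : a ⟶ b), S la * P a = S la
  kp2_source_ghost : ∀ {a b : V} (la : a ⟶ b), P a * Sg la = Sg la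
  kp2_ghost_range : ∀ {a b : V} (la : a ⟶ b), Sg la * P b = Sg la
  kp3_self : ∀ {a b : V} (la : a ⟶ b), Sg la * S la = P a
  kp3_ne : ∀ {a b a' b' : V} (la : a ⟶ b) (mu : a' ⟶ b'),
    G.deg la = G.deg mu → Arrow.mk la ≠ Arrow.mk mu → Sg la * S mu = 0
  kp4 : ∀ (v : V) (n : Fin k → ℕ), P v = ∑ la : G.PathsInto v n, S la.hom * Sg la.hom

/-- Generators of the Kumjian-Pask algebra: vertices, paths and ghost paths. -/
inductive KPGen (V : Type u) [Category.{w} V] : Type (max u w)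
  | vertex (v : V) : KPGen V
  | path {a b : V} (la : a ⟶ b) : KPGen V
  | ghost {a b : V} (la : a ⟶ b) : KPGen V

variable (R : Type x) [CommRing R]

/-- The symbol `p_v` in the free algebra. -/
abbrev freeP (v : V) : FreeAlgebra R (KPGen V) := FreeAlgebra.ι R (KPGen.vertex v)

/-- The symbol `s_λ` in the free algebra. -/
abbrev freeS {a b : V} (la : a ⟶ b) : FreeAlgebra R (KPGen V) := FreeAlgebra.ι R (KPGen.path la)

/-- The symbol `s_{λ*}` in the free algebra. -/
abbrev freeSg {a b : V} (la : a ⟶ b) : FreeAlgebra R (KPGen V) :=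
  FreeAlgebra.ι R (KPGen.ghost la)

/-- The Kumjian-Pask relations in the free unital algebra. -/
inductive KPRel : FreeAlgebra R (KPGen V) → FreeAlgebra R (KPGen V) → Prop
  | S_id (v : V) : KPRel (freeS R (𝟙 v)) (freeP R v)
  | Sg_id (v : V) : KPRel (freeSg R (𝟙 v)) (freeP R v)
  | kp1_self (v : V) : KPRel (freeP R v * freeP R v) (freeP R v)
  | kp1_ne (v v' : V) (h : v ≠ v') : KPRel (freeP R v * freeP R v') 0
  | kp2_path {a b c : V} (mu : a ⟶ b) (la : b ⟶ c) :
      KPRel (freeS R la * freeS R mu) (freeS R (mu ≫ la))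
  | kp2_ghost {a b c : V} (mu : a ⟶ b) (la : b ⟶ c) :
      KPRel (freeSg R mu * freeSg R la) (freeSg R (mu ≫ la))
  | kp2_range_path {a b : V} (la : a ⟶ b) : KPRel (freeP R b * freeS R la) (freeS R la)
  | kp2_path_source {a b : V} (la : a ⟶ b) : KPRel (freeS R la * freeP R a) (freeS R la)
  | kp2_source_ghost {a b : V} (la : a ⟶ b) : KPRel (freeP R a * freeSg R la) (freeSg R la)
  | kp2_ghost_range {a b : V} (la : a ⟶ b) : KPRel (freeSg R la * freeP R b) (freeSg R la)
  | kp3_self {a b : V} (la : a ⟶ b) : KPRel (freeSg R la * freeS R la) (freeP R a)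
  | kp3_ne {a b a' b' : V} (la : a ⟶ b) (mu : a' ⟶ b') (hd : G.deg la = G.deg mu)
      (h : Arrow.mk la ≠ Arrow.mk mu) : KPRel (freeSg R la * freeS R mu) 0
  | kp4 (v : V) (n : Fin k → ℕ) :
      KPRel (freeP R v) (∑ la : G.PathsInto v n, freeS R la.hom * freeSg R la.hom)

/-- The image of a generator in the unital algebra presented by the Kumjian-Pask relations. -/
def kpUnitalGen (g : KPGen V) : RingQuot (G.KPRel R) :=
  RingQuot.mkAlgHom R (G.KPRel R) (FreeAlgebra.ι R g)

/-- The Kumjian-Pask algebra `KP_R(Λ)`, in general without a unit: the non-unital subalgebra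
spanned by the nonempty words in the generators, in the unital algebra presented by the
Kumjian-Pask relations (which is its unitization). Its universal property among non-unital
algebras is proved below. -/
abbrev KPAlgebra : Type (max u w x) :=
  NonUnitalAlgebra.adjoin R (Set.range (G.kpUnitalGen R))

/-- The generators as elements of the Kumjian-Pask algebra. -/
def kpGen (g : KPGen V) : G.KPAlgebra R :=
  ⟨G.kpUnitalGen R g, NonUnitalAlgebra.subset_adjoin R ⟨g, rfl⟩⟩

/-- The element `p_v`. -/
def kpP (v : V) : G.KPAlgebra R := G.kpGen R (KPGen.vertex v)

/-- The element `s_λ`. -/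
def kpS {a b : V} (la : a ⟶ b) : G.KPAlgebra R := G.kpGen R (KPGen.path la)

/-- The element `s_{λ*}`. -/
def kpSg {a b : V} (la : a ⟶ b) : G.KPAlgebra R := G.kpGen R (KPGen.ghost la)

/-- The elements `p_v`, `s_λ`, `s_{λ*}` form a Kumjian-Pask family. -/
theorem kp_isKPFamily : G.IsKPFamily (G.kpP R) (G.kpS R) (G.kpSg R) := by
  have key : ∀ {y z : FreeAlgebra R (KPGen V)}, G.KPRel R y z →
      RingQuot.mkAlgHom R (G.KPRel R) y = RingQuot.mkAlgHom R (G.KPRel R) z :=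
    fun h => RingQuot.mkAlgHom_rel R h
  constructor
  · intro v; exact Subtype.ext (key (.S_id v))
  · intro v; exact Subtype.ext (key (.Sg_id v))
  · intro v; exact Subtype.ext ((map_mul _ _ _).symm.trans (key (.kp1_self v)))
  · intro v v' h
    exact Subtype.ext ((map_mul _ _ _).symm.trans ((key (.kp1_ne v v' h)).trans (map_zero _)))
  · intro a b c mu la; exact Subtype.ext ((map_mul _ _ _).symm.trans (key (.kp2_path mu la)))
  · intro a b c mu la; exact Subtype.ext ((map_mul _ _ _).symm.trans (key (.kp2_ghost mu la)))
  · intro a b la; exact Subtype.ext ((map_mul _ _ _).symm.trans (key (.kp2_range_path la)))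
  · intro a b la; exact Subtype.ext ((map_mul _ _ _).symm.trans (key (.kp2_path_source la)))
  · intro a b la; exact Subtype.ext ((map_mul _ _ _).symm.trans (key (.kp2_source_ghost la)))
  · intro a b la; exact Subtype.ext ((map_mul _ _ _).symm.trans (key (.kp2_ghost_range la)))
  · intro a b la; exact Subtype.ext ((map_mul _ _ _).symm.trans (key (.kp3_self la)))
  · intro a b a' b' la mu hd h
    exact Subtype.ext ((map_mul _ _ _).symm.trans
      ((key (.kp3_ne la mu hd h)).trans (map_zero _)))
  · intro v n
    refine Subtype.ext ((key (.kp4 v n)).trans ?_)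
    rw [map_sum, AddSubmonoidClass.coe_finsetSum]
    exact Finset.sum_congr rfl fun la _ => map_mul _ _ _

/-- The universal property of the Kumjian-Pask algebra. -/
theorem kp_existsUnique_hom {A : Type*} [NonUnitalRing A] [Module R A] [IsScalarTower R A A]
    [SMulCommClass R A A] {P : V → A} {S Sg : ∀ {a b : V}, (a ⟶ b) → A}
    (hF : G.IsKPFamily P S Sg) :
    ∃! φ : G.KPAlgebra R →ₙₐ[R] A, (∀ v, φ (G.kpP R v) = P v) ∧
      (∀ {a b : V} (la : a ⟶ b), φ (G.kpS R la) = S la) ∧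
      (∀ {a b : V} (la : a ⟶ b), φ (G.kpSg R la) = Sg la) := by
  let gen : KPGen V → A := fun g => match g with
    | .vertex v => P v
    | .path la => S la
    | .ghost la => Sg la
  let f : FreeAlgebra R (KPGen V) →ₐ[R] Unitization R A :=
    FreeAlgebra.lift R (fun g => (gen g : Unitization R A))
  have hf : ∀ g, f (FreeAlgebra.ι R g) = (gen g : Unitization R A) := fun g => by
    simp only [f, FreeAlgebra.lift_ι_apply]
  have hrel : ∀ ⦃y z⦄, G.KPRel R y z → f y = f z := by
    intro y z h
    induction h with
    | S_id v => simp only [hf]; exact congrArg _ (hF.S_id v)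
    | Sg_id v => simp only [hf]; exact congrArg _ (hF.Sg_id v)
    | kp1_self v =>
      simp only [map_mul, hf, ← Unitization.inr_mul]; exact congrArg _ (hF.kp1_self v)
    | kp1_ne v v' h =>
      simp only [map_mul, map_zero, hf, ← Unitization.inr_mul]
      exact (congrArg _ (hF.kp1_ne v v' h)).trans (Unitization.inr_zero R)
    | kp2_path mu la =>
      simp only [map_mul, hf, ← Unitization.inr_mul]; exact congrArg _ (hF.kp2_path mu la)
    | kp2_ghost mu la =>
      simp only [map_mul, hf, ← Unitization.inr_mul]; exact congrArg _ (hF.kp2_ghost mu la)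
    | kp2_range_path la =>
      simp only [map_mul, hf, ← Unitization.inr_mul]; exact congrArg _ (hF.kp2_range_path la)
    | kp2_path_source la =>
      simp only [map_mul, hf, ← Unitization.inr_mul]; exact congrArg _ (hF.kp2_path_source la)
    | kp2_source_ghost la =>
      simp only [map_mul, hf, ← Unitization.inr_mul]; exact congrArg _ (hF.kp2_source_ghost la)
    | kp2_ghost_range la =>
      simp only [map_mul, hf, ← Unitization.inr_mul]; exact congrArg _ (hF.kp2_ghost_range la)
    | kp3_self la =>
      simp only [map_mul, hf, ← Unitization.inr_mul]; exact congrArg _ (hF.kp3_self la)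
    | kp3_ne la mu hd h =>
      simp only [map_mul, map_zero, hf, ← Unitization.inr_mul]
      exact (congrArg _ (hF.kp3_ne la mu hd h)).trans (Unitization.inr_zero R)
    | kp4 v n =>
      simp only [map_sum, map_mul, hf, ← Unitization.inr_mul]
      refine (congrArg _ (hF.kp4 v n)).trans ?_
      exact map_sum (Unitization.inrNonUnitalAlgHom R A) _ _
  let F : RingQuot (G.KPRel R) →ₐ[R] Unitization R A := RingQuot.liftAlgHom R ⟨f, hrel⟩
  have hFgen : ∀ g, F (G.kpUnitalGen R g) = (gen g : Unitization R A) := fun g => by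
    simp only [F, kpUnitalGen, RingQuot.liftAlgHom_mkAlgHom_apply, hf]
  have hmem : ∀ y : G.KPAlgebra R, ∃ a : A, F (y : RingQuot (G.KPRel R)) = (a : Unitization R A) := by
    rintro ⟨y, hy⟩
    induction hy using NonUnitalAlgebra.adjoin_induction with
    | mem z hz => obtain ⟨g, rfl⟩ := hz; exact ⟨_, hFgen g⟩
    | add y z _ _ h1 h2 =>
      obtain ⟨a, ha⟩ := h1; obtain ⟨b, hb⟩ := h2
      exact ⟨a + b, by simp only [map_add, ha, hb, Unitization.inr_add]⟩
    | zero => exact ⟨0, by simp only [map_zero, Unitization.inr_zero]⟩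
    | mul y z _ _ h1 h2 =>
      obtain ⟨a, ha⟩ := h1; obtain ⟨b, hb⟩ := h2
      exact ⟨a * b, by simp only [map_mul, ha, hb, Unitization.inr_mul]⟩
    | smul r y _ h1 =>
      obtain ⟨a, ha⟩ := h1
      exact ⟨r • a, by simp only [map_smul, ha, Unitization.inr_smul]⟩
  choose φ hφ using hmem
  have inj := Unitization.inr_injective (R := R) (A := A)
  let Φ : G.KPAlgebra R →ₙₐ[R] A :=
    { toFun := φ
      map_smul' := fun r y => inj (by
        rw [← hφ]; simp only [MonoidHom.id_apply, Unitization.inr_smul, ← hφ]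
        exact map_smul F r _)
      map_zero' := inj (by rw [← hφ, Unitization.inr_zero]; exact map_zero F)
      map_add' := fun y z => inj (by
        rw [← hφ, Unitization.inr_add, ← hφ, ← hφ]; exact map_add F _ _)
      map_mul' := fun y z => inj (by
        rw [← hφ, Unitization.inr_mul, ← hφ, ← hφ]; exact map_mul F _ _) }
  have hΦ : ∀ g, Φ (G.kpGen R g) = gen g := fun g => inj (by
    change ((φ (G.kpGen R g) : A) : Unitization R A) = _
    rw [← hφ]; exact hFgen g)
  refine ⟨Φ, ⟨fun v => hΦ _, fun la => hΦ _, fun la => hΦ _⟩, ?_⟩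
  rintro Ψ ⟨h1, h2, h3⟩
  have hgen : ∀ g, Ψ (G.kpGen R g) = Φ (G.kpGen R g) := by
    intro g
    rw [hΦ]
    cases g with
    | vertex v => exact h1 v
    | path la => exact h2 la
    | ghost la => exact h3 la
  ext ⟨y, hy⟩
  induction hy using NonUnitalAlgebra.adjoin_induction with
  | mem z hz => obtain ⟨g, rfl⟩ := hz; exact hgen g
  | add y z hy hz h1 h2 =>
    have := congrArg₂ (· + ·) h1 h2
    simp only [← map_add] at this
    exact this
  | zero => exact (map_zero Ψ).trans (map_zero Φ).symm
  | mul y z hy hz h1 h2 =>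
    have := congrArg₂ (· * ·) h1 h2
    simp only [← map_mul] at this
    exact this
  | smul r y hy h1 =>
    have := congrArg (r • ·) h1
    simp only [← map_smul] at this
    exact this

/-- The ideal `I(H)` of the Kumjian-Pask algebra generated by a set `H` of vertices. -/
def kpIdeal (H : Set V) : TwoSidedIdeal (G.KPAlgebra R) := TwoSidedIdeal.span (G.kpP R '' H)

end KumjianPask

end HigherRankGraph

/-! ### Minimal left ideals, socle and essential ideals of a ring without unit -/

section Socle

variable {A : Type u} [NonUnitalRing A]

/-- Left ideals of a ring which need not have a unit. -/
def IsLeftIdeal (L : AddSubgroup A) : Prop := ∀ a y : A, y ∈ L → a * y ∈ L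

/-- Minimal left ideals: nonzero left ideals that contain no other nonzero left ideal. -/
def IsMinimalLeftIdeal (L : AddSubgroup A) : Prop :=
  IsLeftIdeal L ∧ L ≠ ⊥ ∧ ∀ L' : AddSubgroup A, IsLeftIdeal L' → L' ≤ L → L' = ⊥ ∨ L' = L

/-- The left ideal `A y = {a y | a ∈ A}`. -/
def leftMultiples (y : A) : AddSubgroup A := (AddMonoidHom.mulRight y).range

variable (A) in
/-- The (left) socle: the sum of all minimal left ideals. -/
def leftSocle : AddSubgroup A := sSup {L | IsMinimalLeftIdeal L}

/-- An essential ideal: a two-sided ideal that meets every nonzero two-sided ideal in a nonzero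
ideal. -/
def IsEssentialIdeal (B : AddSubgroup A) : Prop :=
  ∃ I : TwoSidedIdeal A, (I : Set A) = (B : Set A) ∧
    ∀ J : TwoSidedIdeal A, J ≠ ⊥ → I ⊓ J ≠ ⊥

end Socle

namespace HigherRankGraph

variable {k : ℕ} {V : Type u} [Category.{w} V]

/-! ### Factorization of paths -/

section Factorization

/-! Equality in the talented monoid is tested by expansion: replace each `v(n)` by the sources of
the paths of degree `N - n` into `v`. Equal elements have equal expansions at all high levels `N`
(`talentedCon_le_levelCon`). Hence zero is the only unit, and `v` is an aperiodic atom exactly when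
it receives one path of each degree and any two paths into `v` with a common source have the same
degree (`isAperiodicAtom_state_iff`).

The algebra acts on functions from infinite paths to Laurent polynomials, `s_λ` carrying the
monomial of exponent `d(λ)`. Multiplying a nonzero element on the right by a long path removes all
ghost paths (`exists_mul_path_eq_pathSum`), and a combination of paths is visible at any single
infinite path, since two paths that send `x` to the same place have different degrees
(`pathSum_rep_injective`). So the representation is faithful. Range projections then shrink the
support until all its paths send each `x` to the same place, where the element acts as a nonzero
Laurent polynomial (`exists_reduced_pathSum`, `rep_reduced_pathSum`).

If `p_v` generates a minimal left ideal, a projection separating two infinite paths into `v` would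
contradict minimality, so there is only one; two paths of different degrees would produce a
non-invertible `1 - t^n` in the corner at `v`. Conversely, at an aperiodic atom distinct paths never
send the unique infinite path to the same place, so a nonzero multiple of `p_v` can be inverted term
by term. For the socle, every minimal generator reduces to some minimal `p_v`
(`exists_kpP_of_isMinimalGenerator`), and the relation `kp4` gives the other inclusion. Essentiality
comes down to finding an atom upstream of each vertex, because nonzero ideals have nonzero squares
(`exists_mul_self_ne_zero`). -/

theorem exists_factor (G : HigherRankGraph k V) {a b : V} (la : a ⟶ b) {m n : Fin k → ℕ}
    (h : G.deg la = m + n) :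
    ∃ (c : V) (nu : a ⟶ c) (mu : c ⟶ b), nu ≫ mu = la ∧ G.deg mu = m ∧ G.deg nu = n := by
  obtain ⟨⟨c, nu, mu⟩, h1, -⟩ := G.factorization la m n h
  exact ⟨c, nu, mu, h1⟩

theorem exists_factor_of_le (G : HigherRankGraph k V) {a b : V} (la : a ⟶ b) {m : Fin k → ℕ}
    (h : m ≤ G.deg la) :
    ∃ (c : V) (nu : a ⟶ c) (mu : c ⟶ b), nu ≫ mu = la ∧ G.deg mu = m ∧
      G.deg nu = G.deg la - m :=
  G.exists_factor la (add_tsub_cancel_of_le h).symm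

/-- Cancellation in `ℕ^k` gives the second pair of degrees. The conclusion is an equality in a sigma
type because the middle vertices are not yet known to agree. -/
theorem factor_unique (G : HigherRankGraph k V) {a b c c' : V} {nu : a ⟶ c} {mu : c ⟶ b}
    {nu' : a ⟶ c'} {mu' : c' ⟶ b} (h : nu ≫ mu = nu' ≫ mu') (hd : G.deg mu = G.deg mu') :
    (⟨c, nu, mu⟩ : Σ c : V, (a ⟶ c) × (c ⟶ b)) = ⟨c', nu', mu'⟩ := by
  have h1 : G.deg nu = G.deg nu' := by
    have := congrArg G.deg h
    rw [G.deg_comp, G.deg_comp, hd] at this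
    exact add_left_cancel this
  exact (G.factorization (nu ≫ mu) (G.deg mu) (G.deg nu) (G.deg_comp _ _)).unique
    ⟨rfl, rfl, rfl⟩ ⟨h.symm, hd.symm, h1.symm⟩

theorem comp_right_cancel (G : HigherRankGraph k V) {a b c : V} {nu nu' : a ⟶ c} {mu : c ⟶ b}
    (h : nu ≫ mu = nu' ≫ mu) : nu = nu' := by
  have := G.factor_unique h rfl
  simpa using this

theorem comp_left_cancel (G : HigherRankGraph k V) {a b c : V} {nu : a ⟶ c} {mu mu' : c ⟶ b}
    (h : nu ≫ mu = nu ≫ mu') : mu = mu' := by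
  have h1 : G.deg mu = G.deg mu' := by
    have := congrArg G.deg h
    rw [G.deg_comp, G.deg_comp] at this
    exact add_right_cancel this
  have := G.factor_unique h h1
  simpa using this

/-- `𝟙 a ≫ la` and `la ≫ 𝟙 b` are two factorizations of one path with the same degrees. -/
theorem eq_id_of_deg_eq_zero (G : HigherRankGraph k V) {a b : V} (la : a ⟶ b) (h : G.deg la = 0) :
    (⟨a, la⟩ : Σ a : V, (a ⟶ b)) = ⟨b, 𝟙 b⟩ := by
  have h1 : 𝟙 a ≫ la = la ≫ 𝟙 b := by simp
  have := G.factor_unique h1 (by rw [h, G.deg_id])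
  obtain ⟨h2, h3⟩ := Sigma.mk.inj_iff.1 this
  subst h2
  have h4 : la = 𝟙 a := (Prod.ext_iff.1 (eq_of_heq h3)).2
  rw [h4]

variable {G : HigherRankGraph k V}

theorem PathsInto.deg_hom {v : V} {n : Fin k → ℕ} (f : G.PathsInto v n) : G.deg f.hom = n := f.2

variable (G) in
/-- A path as an element of the set of paths with its range and degree. -/
def toPathsInto {a b : V} (la : a ⟶ b) {n : Fin k → ℕ} (h : G.deg la = n) : G.PathsInto b n :=
  ⟨⟨a, la⟩, h⟩

/-- Concatenation of paths. -/
def PathsInto.append {v : V} {m n : Fin k → ℕ} (α : G.PathsInto v m)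
    (β : G.PathsInto α.source n) : G.PathsInto v (m + n) :=
  G.toPathsInto (β.hom ≫ α.hom) (by rw [G.deg_comp, α.deg_hom, β.deg_hom])

theorem PathsInto.append_bijective (v : V) (m n : Fin k → ℕ) :
    Function.Bijective (fun p : Σ α : G.PathsInto v m, G.PathsInto α.source n =>
      p.1.append p.2) := by
  constructor
  · rintro ⟨⟨⟨c, α⟩, hα⟩, ⟨⟨a, β⟩, hβ⟩⟩ ⟨⟨⟨c', α'⟩, hα'⟩, ⟨⟨a', β'⟩, hβ'⟩⟩ h
    have h1 := congrArg Subtype.val h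
    obtain ⟨h2, h3⟩ := Sigma.mk.inj_iff.1 h1
    change a = a' at h2
    subst h2
    have h4 : β ≫ α = β' ≫ α' := eq_of_heq h3
    change G.deg α = m at hα
    change G.deg α' = m at hα'
    have h5 := G.factor_unique h4 (hα.trans hα'.symm)
    obtain ⟨h6, h7⟩ := Sigma.mk.inj_iff.1 h5
    subst h6
    obtain ⟨rfl, rfl⟩ := Prod.ext_iff.1 (eq_of_heq h7)
    rfl
  · rintro ⟨⟨a, la⟩, hla⟩
    obtain ⟨c, nu, mu, rfl, h2, h3⟩ := G.exists_factor la hla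
    exact ⟨⟨G.toPathsInto mu h2, G.toPathsInto nu h3⟩, rfl⟩

/-- Unique factorization as an equivalence. -/
noncomputable def PathsInto.appendEquiv (v : V) (m n : Fin k → ℕ) :
    (Σ α : G.PathsInto v m, G.PathsInto α.source n) ≃ G.PathsInto v (m + n) :=
  Equiv.ofBijective _ (PathsInto.append_bijective v m n)

theorem PathsInto.sum_append [G.RowFinite] {M : Type*} [AddCommMonoid M] (v : V)
    (m n : Fin k → ℕ) (f : (Σ a : V, (a ⟶ v)) → M) :
    ∑ γ : G.PathsInto v (m + n), f γ.1 =
      ∑ α : G.PathsInto v m, ∑ β : G.PathsInto α.source n, f ⟨β.source, β.hom ≫ α.hom⟩ := by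
  rw [← Equiv.sum_comp (PathsInto.appendEquiv v m n), Fintype.sum_sigma]
  rfl

instance PathsInto.instUniqueZero (v : V) : Unique (G.PathsInto v 0) where
  default := G.toPathsInto (𝟙 v) (G.deg_id v)
  uniq := by
    rintro ⟨⟨a, la⟩, h⟩
    exact Subtype.ext (G.eq_id_of_deg_eq_zero la h)

end Factorization

/-! ### Normal forms in the talented monoid -/

section Level

variable (G : HigherRankGraph k V) [G.RowFinite]

/-- The multiset of the sources of the paths in `vΛⁿ`. -/
noncomputable def sources (v : V) (n : Fin k → ℕ) : Multiset V :=
  ∑ α : G.PathsInto v n, {α.source}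

theorem mem_sources {v w : V} {n : Fin k → ℕ} :
    w ∈ G.sources v n ↔ ∃ α : G.PathsInto v n, α.source = w := by
  simp [sources, Multiset.mem_sum, eq_comm]

theorem sources_add (v : V) (m n : Fin k → ℕ) :
    G.sources v (m + n) = ∑ α : G.PathsInto v m, G.sources α.source n :=
  PathsInto.sum_append v m n (fun f => ({f.1} : Multiset V))

theorem card_sources (v : V) (n : Fin k → ℕ) :
    (G.sources v n).card = Fintype.card (G.PathsInto v n) := by
  simp [sources]

/-- The expansion of a sum of generators of the talented monoid to level `N`. -/
noncomputable def level (N : Fin k → ℤ) : Multiset (V × (Fin k → ℤ)) →+ Multiset V where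
  -- `toNat` truncates at `0`, so the expansion is meaningful only when `N` lies above every level
  -- occurring in `M`.
  toFun M := (M.map fun p => G.sources p.1 fun i => (N i - p.2 i).toNat).sum
  map_zero' := by simp
  map_add' := by simp

theorem level_singleton (N : Fin k → ℤ) (p : V × (Fin k → ℤ)) :
    G.level N {p} = G.sources p.1 fun i => (N i - p.2 i).toNat := by
  change (Multiset.map _ {p}).sum = _
  simp

theorem level_freeShift (N n : Fin k → ℤ) (M : Multiset (V × (Fin k → ℤ))) :
    G.level (N + n) (freeShift n M) = G.level N M := by
  change (Multiset.map _ (Multiset.map _ M)).sum = (Multiset.map _ M).sum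
  simp

theorem level_eq_zero [G.NoSources] {N : Fin k → ℤ} {M : Multiset (V × (Fin k → ℤ))}
    (h : G.level N M = 0) : M = 0 := by
  induction M using Multiset.induction with
  | empty => rfl
  | cons p M ih =>
    rw [← Multiset.singleton_add, map_add, level_singleton, add_eq_zero] at h
    obtain ⟨α⟩ := NoSources.nonempty_pathsInto (G := G) p.1 fun i => (N i - p.2 i).toNat
    have := G.mem_sources.2 ⟨α, rfl⟩
    rw [h.1] at this
    simp at this

/-- Equality of all sufficiently high expansions. -/
def levelCon : AddCon (Multiset (V × (Fin k → ℤ))) where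
  r M M' := ∃ N₀ : Fin k → ℤ, ∀ N, N₀ ≤ N → G.level N M = G.level N M'
  iseqv :=
    ⟨fun _ => ⟨0, fun _ _ => rfl⟩, fun ⟨N, h⟩ => ⟨N, fun _ hN => (h _ hN).symm⟩,
      fun ⟨N, h⟩ ⟨N', h'⟩ => ⟨N ⊔ N', fun _ hN =>
        (h _ (le_sup_left.trans hN)).trans (h' _ (le_sup_right.trans hN))⟩⟩
  add' := fun ⟨N, h⟩ ⟨N', h'⟩ => ⟨N ⊔ N', fun _ hN => by
    rw [map_add, map_add, h _ (le_sup_left.trans hN), h' _ (le_sup_right.trans hN)]⟩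

/-- By unique factorization, a path of degree `N - n` into `v` is an edge of degree `e_i` followed
by a path of degree `N - n - e_i`. This needs `N ≥ n + e_i`, hence the choice of bound. Expansions
thus become invariants of elements of the talented monoid. -/
theorem talentedCon_le_levelCon : G.talentedCon ≤ G.levelCon := by
  refine AddCon.addConGen_le.2 ?_
  rintro _ _ ⟨v, n, i, -⟩
  refine ⟨n + Pi.single i 1, fun N hN => ?_⟩
  rw [map_sum, level_singleton]
  simp only [level_singleton]
  rw [← G.sources_add]
  congr 1
  ext j
  have := hN j
  by_cases hj : j = i
  · subst hj
    simp at this ⊢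
    omega
  · simp [hj] at this ⊢

variable {G} in
theorem exists_level_eq {M M' : Multiset (V × (Fin k → ℤ))}
    (h : G.talentedCon.mk' M = G.talentedCon.mk' M') :
    ∃ N₀ : Fin k → ℤ, ∀ N, N₀ ≤ N → G.level N M = G.level N M' :=
  G.talentedCon_le_levelCon ((AddCon.eq _).1 h)

theorem state_eq_sum_single [G.NoSources] (v : V) (n : Fin k → ℤ) (i : Fin k) :
    G.state v n = ∑ α : G.PathsInto v (Pi.single i 1), G.state α.source (n + Pi.single i 1) :=
  ((AddCon.eq _).2 (AddCon.le_addConGen _ _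
    (TalentedRel.mk v n i (NoSources.nonempty_pathsInto v _)))).trans (map_sum G.talentedCon.mk' _ _)

theorem sum_state_append (v : V) (m n : Fin k → ℕ) (N : Fin k → ℤ) :
    ∑ γ : G.PathsInto v (m + n), G.state γ.source N =
      ∑ α : G.PathsInto v m, ∑ β : G.PathsInto α.source n, G.state β.source N :=
  PathsInto.sum_append v m n (fun f => G.state f.1 N)

theorem state_eq_sum [G.NoSources] (v : V) (n : Fin k → ℤ) (m : Fin k → ℕ) :
    G.state v n = ∑ α : G.PathsInto v m, G.state α.source (n + fun i => (m i : ℤ)) := by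
  -- Induction on the total degree: one edge is split off in a direction `i` where `m i ≠ 0`.
  induction hs : ∑ i, m i generalizing v n m with
  | zero =>
    obtain rfl : m = 0 := by
      ext i
      exact Finset.sum_eq_zero_iff.1 hs i (Finset.mem_univ i)
    rw [Fintype.sum_unique]
    change _ = G.state v _
    congr 1
    ext i
    simp
  | succ s ih =>
    obtain ⟨i, hi⟩ : ∃ i, m i ≠ 0 := by
      by_contra! h
      simp [h] at hs
    obtain ⟨m, rfl⟩ : ∃ m' : Fin k → ℕ, m = Pi.single i 1 + m' := by
      refine ⟨m - Pi.single i 1, (add_tsub_cancel_of_le ?_).symm⟩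
      intro j
      by_cases hj : j = i
      · subst hj; simp; omega
      · simp [hj]
    have hs' : ∑ j, m j = s := by
      simp [Finset.sum_add_distrib] at hs
      omega
    rw [state_eq_sum_single G v n i]
    rw [sum_state_append]
    refine Finset.sum_congr rfl fun α _ => ?_
    rw [ih α.source _ m hs']
    refine Finset.sum_congr rfl fun β _ => ?_
    congr 1
    ext j
    by_cases hj : j = i
    · subst hj; simp; ring
    · simp [hj]

/-- The sum of the states of level `N` of a multiset of vertices. -/
def ofLevel (N : Fin k → ℤ) : Multiset V →+ G.TalentedMonoid :=
  G.talentedCon.mk'.comp (Multiset.mapAddMonoidHom (fun v => (v, N)))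

theorem ofLevel_singleton (N : Fin k → ℤ) (v : V) : G.ofLevel N {v} = G.state v N := rfl

theorem ofLevel_level [G.NoSources] {N : Fin k → ℤ} {M : Multiset (V × (Fin k → ℤ))}
    (h : ∀ p ∈ M, p.2 ≤ N) : G.ofLevel N (G.level N M) = G.talentedCon.mk' M := by
  induction M using Multiset.induction with
  | empty => simp
  | cons p M ih =>
    rw [← Multiset.singleton_add, map_add, map_add, map_add,
      ih fun q hq => h q (Multiset.mem_cons_of_mem hq), level_singleton]
    congr 1
    refine Eq.trans ?_ (G.state_eq_sum p.1 p.2 fun i => (N i - p.2 i).toNat).symm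
    rw [sources, map_sum]
    refine Finset.sum_congr rfl fun α _ => ?_
    rw [ofLevel_singleton]
    congr 1
    ext i
    have : p.2 i ≤ N i := h p (Multiset.mem_cons_self p M) i
    simp
    omega

theorem exists_level_bound {W : Type*} (M : Multiset (W × (Fin k → ℤ))) :
    ∃ N : Fin k → ℤ, ∀ p ∈ M, p.2 ≤ N := by
  induction M using Multiset.induction with
  | empty => exact ⟨0, by simp⟩
  | cons p M ih =>
    obtain ⟨N, hN⟩ := ih
    refine ⟨p.2 ⊔ N, fun q hq => ?_⟩
    rcases Multiset.mem_cons.1 hq with rfl | hq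
    · exact le_sup_left
    · exact (hN q hq).trans le_sup_right

end Level

/-! ### Aperiodic atoms and the order ideal they generate -/

section Atoms

variable {G : HigherRankGraph k V} [G.RowFinite]

theorem shift_shift (m n : Fin k → ℤ) (a : G.TalentedMonoid) :
    G.shift m (G.shift n a) = G.shift (n + m) a := by
  induction a using AddCon.induction_on with
  | H M =>
    change G.talentedCon.mk' (freeShift m (freeShift n M)) = G.talentedCon.mk' (freeShift _ M)
    congr 1
    simp [freeShift, add_assoc]

theorem shift_zero (a : G.TalentedMonoid) : G.shift 0 a = a := by
  induction a using AddCon.induction_on with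
  | H M =>
    change G.talentedCon.mk' (freeShift 0 M) = G.talentedCon.mk' M
    congr 1
    simp [freeShift]

variable (G) in
/-- The action of `n ∈ ℤ^k` as an automorphism of the talented monoid. -/
def shiftEquiv (n : Fin k → ℤ) : G.TalentedMonoid ≃+ G.TalentedMonoid where
  __ := G.shift n
  invFun := G.shift (-n)
  left_inv a := by
    change G.shift _ (G.shift n a) = a
    rw [shift_shift, add_neg_cancel, shift_zero]
  right_inv a := by
    change G.shift n (G.shift _ a) = a
    rw [shift_shift, neg_add_cancel, shift_zero]

theorem isAperiodicAtom_shift {a : G.TalentedMonoid} (n : Fin k → ℤ) (ha : IsAperiodicAtom a) :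
    IsAperiodicAtom (G.shift n a) := by
  obtain ⟨h1, h2, h3⟩ := ha
  refine ⟨(AddEquiv.addIrreducible_iff (G.shiftEquiv n)).2 h1, fun h => h2 ?_, fun m hm => h3 m ?_⟩
  · exact (map_eq_zero_iff (G.shiftEquiv n) (G.shiftEquiv n).injective).1 h
  · apply (G.shiftEquiv n).injective
    change G.shift n (G.shift m a) = G.shift n a
    rw [shift_shift, add_comm m, ← shift_shift, hm]

theorem isAperiodicAtom_state_iff_zero (v : V) (n : Fin k → ℤ) :
    IsAperiodicAtom (G.state v n) ↔ IsAperiodicAtom (G.state v 0) := by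
  constructor
  · intro h
    have := isAperiodicAtom_shift (-n) h
    rwa [shift_state, add_neg_cancel] at this
  · intro h
    have := isAperiodicAtom_shift n h
    rwa [shift_state, zero_add] at this

variable (G) in
/-- The elements of the talented monoid all of whose sufficiently high expansions consist of
aperiodic atoms. -/
def eventuallyAtomic : AddSubmonoid G.TalentedMonoid where
  carrier := {a | ∃ M, a = G.talentedCon.mk' M ∧ ∃ N₀ : Fin k → ℤ, ∀ N, N₀ ≤ N →
    ∀ v ∈ G.level N M, IsAperiodicAtom (G.state v 0)}
  zero_mem' := ⟨0, rfl, 0, by simp⟩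
  add_mem' := by
    rintro _ _ ⟨M, rfl, N, h⟩ ⟨M', rfl, N', h'⟩
    refine ⟨M + M', rfl, N ⊔ N', fun L hL v hv => ?_⟩
    rw [map_add, Multiset.mem_add] at hv
    exact hv.elim (h _ (le_sup_left.trans hL) v) (h' _ (le_sup_right.trans hL) v)

/-- Independence of the representative: two representatives have the same high expansions. -/
theorem mem_eventuallyAtomic {M : Multiset (V × (Fin k → ℤ))} :
    G.talentedCon.mk' M ∈ G.eventuallyAtomic ↔ ∃ N₀ : Fin k → ℤ, ∀ N, N₀ ≤ N →
      ∀ v ∈ G.level N M, IsAperiodicAtom (G.state v 0) := by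
  constructor
  · rintro ⟨M', h1, N, h2⟩
    obtain ⟨N', h3⟩ := exists_level_eq (G := G) h1
    refine ⟨N ⊔ N', fun L hL v hv => h2 L (le_sup_left.trans hL) v ?_⟩
    rwa [← h3 L (le_sup_right.trans hL)]
  · exact fun h => ⟨M, rfl, h⟩

theorem isOrderIdeal_eventuallyAtomic : IsOrderIdeal G.eventuallyAtomic where
  mem_of_le a b := by
    rintro ⟨c, rfl⟩ h
    induction a using AddCon.induction_on with
    | H M =>
      induction c using AddCon.induction_on with
      | H M' =>
        obtain ⟨N, hN⟩ := mem_eventuallyAtomic (M := M + M') |>.1 h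
        refine mem_eventuallyAtomic.2 ⟨N, fun L hL v hv => hN L hL v ?_⟩
        rw [map_add, Multiset.mem_add]
        exact Or.inl hv
  shift_mem n a h := by
    induction a using AddCon.induction_on with
    | H M =>
      obtain ⟨N, hN⟩ := mem_eventuallyAtomic.1 h
      refine mem_eventuallyAtomic (M := freeShift n M) |>.2 ⟨N + n, fun L hL v hv =>
        hN (L - n) (le_sub_iff_add_le.2 hL) v ?_⟩
      rwa [← sub_add_cancel L n, level_freeShift] at hv

variable [G.NoSources]

theorem mk_eq_zero {M : Multiset (V × (Fin k → ℤ))} (h : G.talentedCon.mk' M = 0) : M = 0 := by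
  obtain ⟨N, hN⟩ := exists_level_eq (G := G) (h.trans (map_zero G.talentedCon.mk').symm)
  exact G.level_eq_zero ((hN N le_rfl).trans (map_zero _))

theorem state_ne_zero (v : V) (n : Fin k → ℤ) : G.state v n ≠ 0 := fun h => by
  simpa using mk_eq_zero h

theorem isAddUnit_iff_eq_zero {a : G.TalentedMonoid} : IsAddUnit a ↔ a = 0 := by
  constructor
  · rw [isAddUnit_iff_exists]
    rintro ⟨b, h, -⟩
    induction a using AddCon.induction_on with
    | H M =>
      induction b using AddCon.induction_on with
      | H M' =>
        have := mk_eq_zero (G := G) (M := M + M') h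
        rw [(add_eq_zero.1 this).1]
        rfl
  · rintro rfl
    exact isAddUnit_zero

/-- Two distinct paths of degree `n` split `v` into two nonzero summands. Conversely, if there is at
most one path of each degree, every expansion has at most one element, and in a decomposition one
summand must have empty expansion. -/
theorem addIrreducible_state_iff (v : V) :
    AddIrreducible (G.state v 0) ↔ ∀ n, Subsingleton (G.PathsInto v n) := by
  classical
  constructor
  · intro h n
    refine ⟨fun α β => ?_⟩
    by_contra hne
    have h1 := G.state_eq_sum v 0 n
    rw [← Finset.add_sum_erase _ _ (Finset.mem_univ α),
      ← Finset.add_sum_erase _ _ (Finset.mem_erase.2 ⟨Ne.symm hne, Finset.mem_univ β⟩)] at h1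
    rcases h.isAddUnit_or_isAddUnit h1 with h2 | h2
    · exact state_ne_zero _ _ (isAddUnit_iff_eq_zero.1 h2)
    · exact state_ne_zero _ _ (isAddUnit_iff_eq_zero.1 (isAddUnit_of_add_isAddUnit_left h2))
  · intro h
    refine ⟨fun h1 => state_ne_zero _ _ (isAddUnit_iff_eq_zero.1 h1), ?_⟩
    intro a b hab
    induction a using AddCon.induction_on with
    | H M =>
      induction b using AddCon.induction_on with
      | H M' =>
        obtain ⟨N, hN⟩ := exists_level_eq (G := G) (M := {(v, 0)}) (M' := M + M') hab
        have h1 := congrArg Multiset.card (hN N le_rfl)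
        rw [level_singleton, card_sources, map_add, Multiset.card_add] at h1
        have h2 := Fintype.card_le_one_iff_subsingleton.2 (h fun i => (N i - 0).toNat)
        have h3 : (G.level N M).card + (G.level N M').card ≤ 1 := h1 ▸ h2
        have h4 : (G.level N M).card = 0 ∨ (G.level N M').card = 0 := by omega
        refine h4.imp (fun h5 => ?_) (fun h5 => ?_)
        · rw [G.level_eq_zero (Multiset.card_eq_zero.1 h5)]
          exact isAddUnit_zero
        · rw [G.level_eq_zero (Multiset.card_eq_zero.1 h5)]
          exact isAddUnit_zero

theorem state_eq_of_subsingleton {v a : V} (h : ∀ n, Subsingleton (G.PathsInto v n))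
    (la : a ⟶ v) (n : Fin k → ℤ) : G.state v n = G.state a (n + fun i => (G.deg la i : ℤ)) := by
  have := h (G.deg la)
  rw [G.state_eq_sum v n (G.deg la), Fintype.sum_subsingleton _ (G.toPathsInto la rfl)]
  rfl

/-- When `v` receives one path of each degree, a path `λ` into it from `a` gives `v = a(d(λ))`. Two
paths from `a` of different degrees therefore yield a period, and a period, read off at a high
level, yields two such paths. -/
theorem isAperiodicAtom_state_iff (v : V) :
    IsAperiodicAtom (G.state v 0) ↔ (∀ n, Subsingleton (G.PathsInto v n)) ∧
      ∀ (a : V) (la mu : a ⟶ v), G.deg la = G.deg mu := by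
  refine (and_congr_left' (addIrreducible_state_iff v)).trans (and_congr_right fun h => ?_)
  constructor
  · rintro ⟨-, h1⟩ a la mu
    have h2 := (state_eq_of_subsingleton h la 0).symm.trans
      (state_eq_of_subsingleton h mu 0)
    have h3 := h1 (fun i => (G.deg la i : ℤ) - G.deg mu i) (by
      rw [state_eq_of_subsingleton h mu 0, shift_state, ← h2]
      congr 1
      ext i
      simp)
    ext i
    have := congrFun h3 i
    simp at this
    omega
  · intro h1
    refine ⟨state_ne_zero _ _, fun n hn => ?_⟩
    rw [shift_state, zero_add] at hn
    obtain ⟨N, hN⟩ := exists_level_eq (G := G) (M := {(v, n)}) (M' := {(v, 0)}) hn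
    -- A level above both `n` and `0` avoids truncation by `toNat`, so that equality of the degrees
    -- of `α` and `β` gives `n = 0`.
    have h2 := hN (N ⊔ n ⊔ 0) (le_sup_left.trans le_sup_left)
    have h3 : n ≤ N ⊔ n ⊔ 0 := le_sup_right.trans le_sup_left
    have h4 : (0 : Fin k → ℤ) ≤ N ⊔ n ⊔ 0 := le_sup_right
    generalize N ⊔ n ⊔ 0 = N' at h2 h3 h4
    rw [level_singleton, level_singleton] at h2
    obtain ⟨α⟩ := NoSources.nonempty_pathsInto (G := G) v fun i => (N' i - n i).toNat
    have h5 := G.mem_sources.2 ⟨α, rfl⟩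
    change α.source ∈ G.sources (v, n).1 fun i => (N' i - (v, n).2 i).toNat at h5
    rw [h2, mem_sources] at h5
    obtain ⟨β, hβ⟩ := h5
    have h6 : ∀ {a b : V} (la : a ⟶ v) (mu : b ⟶ v), a = b → G.deg la = G.deg mu := by
      rintro a b la mu rfl
      exact h1 a la mu
    have h7 := h6 α.hom β.hom hβ.symm
    rw [α.deg_hom, β.deg_hom] at h7
    ext i
    have h8 := congrFun h7 i
    have h9 := h3 i
    have h10 := h4 i
    simp at h8 h9 h10 ⊢
    omega

theorem isAperiodicAtom_source {v a : V} (h : IsAperiodicAtom (G.state v 0)) (la : a ⟶ v) :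
    IsAperiodicAtom (G.state a 0) := by
  rw [state_eq_of_subsingleton ((isAperiodicAtom_state_iff v).1 h).1 la 0,
    isAperiodicAtom_state_iff_zero] at h
  exact h

/-- At a high level `L` the atom is a sum of states `v(L)`, all nonzero, so it equals any one of
them. -/
theorem aperiodicAtom_mem_eventuallyAtomic {a : G.TalentedMonoid} (h : IsAperiodicAtom a) :
    a ∈ G.eventuallyAtomic := by
  induction a using AddCon.induction_on with
  | H M =>
    obtain ⟨N, hN⟩ := exists_level_bound M
    refine mem_eventuallyAtomic.2 ⟨N, fun L hL v hv => ?_⟩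
    obtain ⟨W, hW⟩ := Multiset.exists_cons_of_mem hv
    have h1 := G.ofLevel_level (N := L) (M := M) fun p hp => (hN p hp).trans hL
    rw [hW, ← Multiset.singleton_add, map_add, ofLevel_singleton] at h1
    have h2 : G.state v L + G.ofLevel L W = G.talentedCon.mk' M := h1
    rcases h.1.isAddUnit_or_isAddUnit h2.symm with h3 | h3
    · exact absurd (isAddUnit_iff_eq_zero.1 h3) (state_ne_zero _ _)
    · rw [isAddUnit_iff_eq_zero.1 h3, add_zero] at h2
      rw [← isAperiodicAtom_state_iff_zero v L, h2]
      exact h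

/-- `eventuallyAtomic` is an order ideal containing the aperiodic atoms, which bounds the generated
ideal from above; the converse expands `v` to level `n`. -/
theorem mem_vertexSet_aperiodicAtom_iff (v : V) :
    v ∈ vertexSet (orderIdealSpan {a : G.TalentedMonoid | IsAperiodicAtom a}) ↔
      ∃ n, ∀ α : G.PathsInto v n, IsAperiodicAtom (G.state α.source 0) := by
  constructor
  · intro h
    have h1 : G.state v 0 ∈ G.eventuallyAtomic :=
      (AddSubmonoid.mem_sInf.1 h) _ ⟨isOrderIdeal_eventuallyAtomic,
        fun a ha => aperiodicAtom_mem_eventuallyAtomic ha⟩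
    obtain ⟨N, hN⟩ := mem_eventuallyAtomic (M := {(v, 0)}) |>.1 h1
    refine ⟨fun i => (N i - 0).toNat, fun α => hN N le_rfl α.source ?_⟩
    rw [level_singleton, mem_sources]
    exact ⟨α, rfl⟩
  · rintro ⟨n, hn⟩
    refine AddSubmonoid.mem_sInf.2 ?_
    rintro J ⟨-, hJ⟩
    rw [G.state_eq_sum v 0 n]
    exact sum_mem fun α _ => hJ ((isAperiodicAtom_state_iff_zero _ _).2 (hn α))

/-- If `w(m) ≤ v`, the expansion of `w(m)` sits inside that of `v` at a high level. So some path
into `w` and some path into `v` share a source, which inherits being an atom from `w`. -/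
theorem exists_aperiodicAtom_algLE_iff (v : V) :
    (∃ (w : V) (m : Fin k → ℕ), AlgLE (G.state w (fun i => (m i : ℤ))) (G.state v 0) ∧
      IsAperiodicAtom (G.state w (fun i => (m i : ℤ)))) ↔
    ∃ (a : V) (_ : a ⟶ v), IsAperiodicAtom (G.state a 0) := by
  classical
  constructor
  · rintro ⟨w, m, ⟨c, hc⟩, hw⟩
    rw [isAperiodicAtom_state_iff_zero] at hw
    induction c using AddCon.induction_on with
    | H M =>
      obtain ⟨N, hN⟩ := exists_level_eq (G := G) (M := {(v, 0)})
        (M' := {(w, fun i => (m i : ℤ))} + M) hc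
      have h1 := hN N le_rfl
      rw [map_add, level_singleton, level_singleton] at h1
      obtain ⟨α⟩ := NoSources.nonempty_pathsInto (G := G) w fun i => (N i - m i).toNat
      have h2 := Multiset.mem_add.2 (Or.inl (G.mem_sources.2 ⟨α, rfl⟩) :
        _ ∨ α.source ∈ G.level N M)
      have h3 : α.source ∈ G.sources v fun i => (N i - 0).toNat := by
        refine Eq.mpr (congrArg (α.source ∈ ·) h1) h2
      obtain ⟨β, hβ⟩ := G.mem_sources.1 h3
      refine ⟨β.source, β.hom, ?_⟩
      rw [hβ]
      exact isAperiodicAtom_source hw α.hom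
  · rintro ⟨a, la, ha⟩
    refine ⟨a, G.deg la, ⟨∑ α ∈ Finset.univ.erase (G.toPathsInto la rfl),
      G.state α.source (fun i => (G.deg la i : ℤ)), ?_⟩, (isAperiodicAtom_state_iff_zero _ _).2 ha⟩
    rw [G.state_eq_sum v 0 (G.deg la), zero_add]
    exact (Finset.add_sum_erase _ _ (Finset.mem_univ (G.toPathsInto la rfl))).symm

end Atoms

/-! ### Infinite paths -/

section InfinitePaths

/-- The path `p` starts, at its range, with the path `f`. -/
def Extends {v : V} (p f : Σ a : V, (a ⟶ v)) : Prop := ∃ ξ : p.1 ⟶ f.1, ξ ≫ f.2 = p.2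

theorem Extends.trans {v : V} {p f g : Σ a : V, (a ⟶ v)} (h : Extends p f) (h' : Extends f g) :
    Extends p g := by
  obtain ⟨ξ, h⟩ := h
  obtain ⟨ζ, h'⟩ := h'
  exact ⟨ξ ≫ ζ, by rw [Category.assoc, h', h]⟩

theorem Extends.comp {a b : V} {p f : Σ c : V, (c ⟶ a)} (h : Extends p f) (la : a ⟶ b) :
    Extends (⟨p.1, p.2 ≫ la⟩ : Σ c : V, (c ⟶ b)) ⟨f.1, f.2 ≫ la⟩ := by
  obtain ⟨ξ, h⟩ := h
  exact ⟨ξ, by rw [← h, Category.assoc]⟩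

theorem Extends.unique (G : HigherRankGraph k V) {v : V} {p f g : Σ a : V, (a ⟶ v)}
    (h : Extends p f) (h' : Extends p g) (hd : G.deg f.2 = G.deg g.2) : f = g := by
  obtain ⟨c, f⟩ := f
  obtain ⟨c', g⟩ := g
  obtain ⟨ξ, h⟩ := h
  obtain ⟨ζ, h'⟩ := h'
  obtain ⟨h1, h2⟩ := Sigma.mk.inj_iff.1 (G.factor_unique (h.trans h'.symm) hd)
  subst h1
  obtain ⟨-, rfl⟩ := Prod.ext_iff.1 (eq_of_heq h2)
  rfl

theorem Extends.unique' {G : HigherRankGraph k V} {v : V} {n : Fin k → ℕ}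
    {p : Σ a : V, (a ⟶ v)} {f g : G.PathsInto v n} (h : Extends p f.1) (h' : Extends p g.1) :
    f = g :=
  Subtype.ext (h.unique G h' (f.2.trans g.2.symm))

variable (G : HigherRankGraph k V)

theorem exists_extends {v : V} (p : Σ a : V, (a ⟶ v)) {n : Fin k → ℕ} (h : n ≤ G.deg p.2) :
    ∃ f : G.PathsInto v n, Extends p f.1 := by
  obtain ⟨c, nu, mu, h1, h2, -⟩ := G.exists_factor_of_le p.2 h
  exact ⟨G.toPathsInto mu h2, nu, h1⟩

/-- Infinite paths with range `v`, given by their initial segments. -/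
@[ext]
structure InfPath (v : V) where
  /-- The initial segment of a given degree. -/
  seg : ∀ n, G.PathsInto v n
  compat : ∀ ⦃m n⦄, m ≤ n → Extends (seg n).1 (seg m).1

variable {G}

theorem InfPath.ext_of_extends {v : V} {x y : G.InfPath v}
    (h : ∀ n, ∃ p : Σ a : V, (a ⟶ v), Extends p (x.seg n).1 ∧ Extends p (y.seg n).1) : x = y := by
  ext1
  funext n
  obtain ⟨p, h1, h2⟩ := h n
  exact h1.unique' h2

theorem le_deg_comp_seg {a b : V} (la : a ⟶ b) (x : G.InfPath a) (n : Fin k → ℕ) :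
    n ≤ G.deg ((x.seg n).hom ≫ la) := by
  rw [G.deg_comp, (x.seg n).deg_hom]
  exact le_add_self

/-- The infinite path `λx`. -/
noncomputable def InfPath.prepend {a b : V} (la : a ⟶ b) (x : G.InfPath a) : G.InfPath b where
  -- The path `λ x(0,n)` has degree `d(λ) + n ≥ n`, so it has an initial segment of degree `n`.
  seg n := (G.exists_extends ⟨(x.seg n).source, (x.seg n).hom ≫ la⟩
    (le_deg_comp_seg la x n)).choose
  compat m n hmn := by
    have h1 := (G.exists_extends ⟨(x.seg n).source, (x.seg n).hom ≫ la⟩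
      (le_deg_comp_seg la x n)).choose_spec
    have h2 := (G.exists_extends ⟨(x.seg m).source, (x.seg m).hom ≫ la⟩
      (le_deg_comp_seg la x m)).choose_spec
    generalize (G.exists_extends ⟨(x.seg n).source, (x.seg n).hom ≫ la⟩
      (le_deg_comp_seg la x n)).choose = f at h1 ⊢
    generalize (G.exists_extends ⟨(x.seg m).source, (x.seg m).hom ≫ la⟩
      (le_deg_comp_seg la x m)).choose = g at h2 ⊢
    obtain ⟨g', h3⟩ := G.exists_extends f.1 (n := m) (hmn.trans f.2.ge)
    have h4 := ((x.compat hmn).comp la).trans h2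
    rwa [h4.unique' (h1.trans h3)]

theorem InfPath.extends_prepend {a b : V} (la : a ⟶ b) (x : G.InfPath a) (n : Fin k → ℕ) :
    Extends ⟨(x.seg n).source, (x.seg n).hom ≫ la⟩ ((x.prepend la).seg n).1 :=
  (G.exists_extends ⟨(x.seg n).source, (x.seg n).hom ≫ la⟩ (le_deg_comp_seg la x n)).choose_spec

theorem InfPath.prepend_id {a : V} (x : G.InfPath a) : x.prepend (𝟙 a) = x :=
  ext_of_extends fun n => ⟨_, x.extends_prepend (𝟙 a) n, 𝟙 _,
    (Category.id_comp _).trans (Category.comp_id _).symm⟩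

theorem InfPath.prepend_comp {a b c : V} (mu : a ⟶ b) (la : b ⟶ c) (x : G.InfPath a) :
    x.prepend (mu ≫ la) = (x.prepend mu).prepend la :=
  ext_of_extends fun n => ⟨_, x.extends_prepend (mu ≫ la) n, by
    have := ((x.extends_prepend mu n).comp la).trans ((x.prepend mu).extends_prepend la n)
    rwa [Category.assoc] at this⟩

theorem InfPath.seg_prepend {a b : V} (la : a ⟶ b) (x : G.InfPath a) (m : Fin k → ℕ) :
    ((x.prepend la).seg (G.deg la + m)).1 = ⟨(x.seg m).source, (x.seg m).hom ≫ la⟩ := by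
  have h1 := x.extends_prepend la (G.deg la + m)
  have h2 := (x.compat (le_add_self : m ≤ G.deg la + m)).comp la
  refine h1.unique G h2 ?_
  change G.deg ((x.prepend la).seg (G.deg la + m)).hom = G.deg ((x.seg m).hom ≫ la)
  rw [PathsInto.deg_hom, G.deg_comp, PathsInto.deg_hom]

theorem InfPath.seg_prepend_self {a b : V} (la : a ⟶ b) (x : G.InfPath a) {n : Fin k → ℕ}
    (h : G.deg la = n) : (x.prepend la).seg n = G.toPathsInto la h := by
  have h1 := x.extends_prepend la n
  exact h1.unique' (g := G.toPathsInto la h) ⟨(x.seg n).hom, rfl⟩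

theorem InfPath.prepend_injective {a b : V} (la : a ⟶ b) :
    Function.Injective (InfPath.prepend la : G.InfPath a → G.InfPath b) := by
  intro x y h
  ext1
  funext m
  have h1 := (x.seg_prepend la m).symm.trans
    ((congrArg (fun z : G.InfPath b => (z.seg (G.deg la + m)).1) h).trans
    (y.seg_prepend la m))
  generalize x.seg m = p at h1 ⊢
  generalize y.seg m = q at h1 ⊢
  obtain ⟨⟨c, f⟩, hf⟩ := p
  obtain ⟨⟨c', g⟩, hg⟩ := q
  obtain ⟨h2, h3⟩ := Sigma.mk.inj_iff.1 h1
  change c = c' at h2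
  subst h2
  have h4 : f = g := G.comp_right_cancel (eq_of_heq h3)
  subst h4
  rfl

/-- The shift map: the tail's segment of degree `m` is what remains of `y(0, n + m)` after removing
`y(0, n)`. -/
theorem InfPath.exists_prepend {v : V} (y : G.InfPath v) (n : Fin k → ℕ) :
    ∃ x : G.InfPath (y.seg n).source, x.prepend (y.seg n).hom = y := by
  choose ξ hξ using fun m : Fin k → ℕ => y.compat (le_self_add : n ≤ n + m)
  have hd : ∀ m, G.deg (ξ m) = m := fun m => by
    have h1 := congrArg G.deg (hξ m)
    rw [G.deg_comp] at h1
    have h2 : G.deg (y.seg n).1.2 = n := (y.seg n).2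
    have h3 : G.deg (y.seg (n + m)).1.2 = n + m := (y.seg (n + m)).2
    rw [h2, h3] at h1
    exact add_left_cancel h1
  refine ⟨⟨fun m => G.toPathsInto (ξ m) (hd m), fun m l hml => ?_⟩, ?_⟩
  · obtain ⟨ζ, hζ⟩ := y.compat (add_le_add_right hml n)
    refine ⟨ζ, G.comp_right_cancel (mu := (y.seg n).hom) ?_⟩
    exact (Category.assoc _ _ _).trans (((congrArg (ζ ≫ ·) (hξ m)).trans hζ).trans (hξ l).symm)
  · refine ext_of_extends fun m => ⟨_, InfPath.extends_prepend _ _ m, ?_⟩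
    have h1 := y.compat (le_add_self : m ≤ n + m)
    obtain ⟨ζ, hζ⟩ := h1
    exact ⟨ζ, hζ.trans (hξ m).symm⟩

/-- Both paths are the initial segment of the same degree of one infinite path. -/
theorem InfPath.arrow_eq_of_prepend_eq {a a' b b' : V} {la : a ⟶ b} {mu : a' ⟶ b'}
    {x : G.InfPath a} {y : G.InfPath a'}
    (h : (⟨b, x.prepend la⟩ : Σ v, G.InfPath v) = ⟨b', y.prepend mu⟩)
    (hd : G.deg la = G.deg mu) : Arrow.mk la = Arrow.mk mu := by
  obtain ⟨h1, h2⟩ := Sigma.mk.inj_iff.1 h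
  subst h1
  have h3 := congrArg (fun z : G.InfPath b => (z.seg (G.deg la)).1) (eq_of_heq h2)
  simp only [InfPath.seg_prepend_self la x rfl, InfPath.seg_prepend_self mu y hd.symm] at h3
  obtain ⟨h4, h5⟩ := Sigma.mk.inj_iff.1 h3
  subst h4
  rw [eq_of_heq h5]

/-- König's lemma: the sets of paths of given degree into `v` form an inverse system of finite
nonempty sets, and its sections are infinite paths. -/
instance InfPath.instNonempty [hG : G.RowFinite] [hN : G.NoSources] (v : V) :
    Nonempty (G.InfPath v) := by
  classical
  have hres : ∀ {m n : Fin k → ℕ}, m ≤ n → ∀ f : G.PathsInto v n,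
      ∃ g : G.PathsInto v m, Extends f.1 g.1 :=
    fun hmn f => G.exists_extends f.1 (hmn.trans f.2.ge)
  choose res hresE using @hres
  let _ : Category (Fin k → ℕ) := Preorder.smallCategory _
  let Φ : (Fin k → ℕ)ᵒᵖ ⥤ Type (max u w) :=
    { obj := fun n => G.PathsInto v n.unop
      map := fun f => ↾(res (leOfHom f.unop))
      map_id := fun n => by
        ext f
        exact (hresE le_rfl f).unique' ⟨𝟙 _, Category.id_comp _⟩
      map_comp := fun f g => by
        ext h
        exact (hresE _ h).unique' ((hresE (leOfHom f.unop) h).trans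
          (hresE (leOfHom g.unop) (res (leOfHom f.unop) h))) }
  have : ∀ n, Finite (Φ.obj n) := fun n => hG.finite_pathsInto v n.unop
  have : ∀ n, Nonempty (Φ.obj n) := fun n => hN.nonempty_pathsInto v n.unop
  obtain ⟨s, hs⟩ := nonempty_sections_of_finite_inverse_system Φ
  refine ⟨⟨fun n => s (Opposite.op n), fun m n hmn => ?_⟩⟩
  have h1 := hs (homOfLE hmn).op
  rw [← h1]
  exact hresE _ _

end InfinitePaths

/-! ### The infinite path representation -/

section Representation

variable {G : HigherRankGraph k V}

/-- The map `x ↦ λx` on the space of all infinite paths. -/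
noncomputable def concat {a b : V} (la : a ⟶ b) (x : G.InfPath a) : Σ v, G.InfPath v :=
  ⟨b, x.prepend la⟩

theorem concat_id {a : V} (x : G.InfPath a) : concat (𝟙 a) x = ⟨a, x⟩ := by
  rw [concat, InfPath.prepend_id]

theorem concat_comp {a b c : V} (mu : a ⟶ b) (la : b ⟶ c) (x : G.InfPath a) :
    concat (mu ≫ la) x = concat la (x.prepend mu) := by
  rw [concat, concat, InfPath.prepend_comp]

theorem concat_injective {a b : V} (la : a ⟶ b) :
    Function.Injective (concat la : G.InfPath a → _) := fun _ _ h =>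
  InfPath.prepend_injective la (eq_of_heq (Sigma.mk.inj_iff.1 h).2)

variable (G) in
/-- Functions on the infinite path space with values in the Laurent polynomials. -/
abbrev PathModule (F : Type x) [CommRing F] : Type (max u w x) :=
  (Σ v, G.InfPath v) → AddMonoidAlgebra F (Fin k → ℤ)

variable {F : Type x} [CommRing F]

local notation "𝓛" => AddMonoidAlgebra F (Fin k → ℤ)

/-- Transport of functions along `x ↦ λx`, extended by zero. -/
noncomputable def push {a b : V} (la : a ⟶ b) : (G.InfPath a → 𝓛) →ₗ[𝓛] G.PathModule F :=
  Function.ExtendByZero.linearMap _ (concat la)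

/-- Composition of functions with `x ↦ λx`. -/
noncomputable def pull {a b : V} (la : a ⟶ b) : G.PathModule F →ₗ[𝓛] (G.InfPath a → 𝓛) :=
  LinearMap.funLeft _ _ (concat la)

theorem pull_apply {a b : V} (la : a ⟶ b) (g : G.PathModule F) (x : G.InfPath a) :
    pull la g x = g (concat la x) := rfl

theorem push_apply {a b : V} (la : a ⟶ b) (g : G.InfPath a → 𝓛) (x : G.InfPath a) :
    push la g (concat la x) = g x :=
  (concat_injective la).extend_apply _ _ _

theorem push_apply_of_notMem {a b : V} (la : a ⟶ b) (g : G.InfPath a → 𝓛)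
    {y : Σ v, G.InfPath v} (h : ∀ x, concat la x ≠ y) : push la g y = 0 :=
  Function.extend_apply' _ _ _ (by rintro ⟨x, hx⟩; exact h x hx)

theorem pull_push_self {a b : V} (la : a ⟶ b) (g : G.InfPath a → 𝓛) :
    pull la (push la g) = g :=
  funext fun _ => push_apply _ _ _

theorem pull_push_ne {a b a' b' : V} (la : a ⟶ b) (mu : a' ⟶ b') (hd : G.deg la = G.deg mu)
    (h : Arrow.mk la ≠ Arrow.mk mu) (g : G.InfPath a' → 𝓛) : pull la (push mu g) = 0 :=
  funext fun _ => push_apply_of_notMem _ _ fun _ hy =>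
    h (InfPath.arrow_eq_of_prepend_eq hy hd.symm).symm

theorem push_pull_id_push {a b c : V} (mu : a ⟶ b) (la : b ⟶ c) (g : G.InfPath a → 𝓛) :
    push la (pull (𝟙 b) (push mu g)) = push (mu ≫ la) g := by
  funext y
  by_cases h : ∃ x, concat (mu ≫ la) x = y
  · obtain ⟨x, rfl⟩ := h
    rw [push_apply, concat_comp, push_apply, pull_apply, concat_id]
    exact push_apply _ _ _
  · push Not at h
    rw [push_apply_of_notMem _ _ h]
    by_cases h' : ∃ z, concat la z = y
    · obtain ⟨z, rfl⟩ := h'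
      rw [push_apply, pull_apply, concat_id]
      refine push_apply_of_notMem _ _ fun x hx => h x ?_
      rw [concat_comp]
      exact congrArg _ (eq_of_heq (Sigma.mk.inj_iff.1 hx).2)
    · push Not at h'
      exact push_apply_of_notMem _ _ h'

theorem pull_push_id_pull {a b c : V} (mu : a ⟶ b) (la : b ⟶ c) (g : G.PathModule F) :
    pull mu (push (𝟙 b) (pull la g)) = pull (mu ≫ la) g := by
  funext x
  rw [pull_apply, pull_apply, concat_comp]
  have := push_apply (𝟙 b) (pull la g) (x.prepend mu)
  rwa [concat_id] at this

variable (G F) in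
/-- The projection to the functions on the infinite paths with range `v`. -/
noncomputable def repP (v : V) : Module.End 𝓛 (G.PathModule F) :=
  push (𝟙 v) ∘ₗ pull (𝟙 v)

/-- The monomial of exponent `d(λ)`. -/
noncomputable def weight (F : Type x) [CommRing F] (n : Fin k → ℤ) :
    AddMonoidAlgebra F (Fin k → ℤ) := AddMonoidAlgebra.single n 1

theorem weight_add (m n : Fin k → ℤ) : weight F m * weight F n = weight F (m + n) := by
  simp [weight, AddMonoidAlgebra.single_mul_single]

theorem weight_zero : weight F (0 : Fin k → ℤ) = 1 := rfl

variable (G) in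
/-- The degree of a path as an element of `ℤ^k`. -/
def degZ {a b : V} (la : a ⟶ b) : Fin k → ℤ := fun i => G.deg la i

theorem degZ_comp {a b c : V} (mu : a ⟶ b) (la : b ⟶ c) :
    G.degZ (mu ≫ la) = G.degZ la + G.degZ mu := by
  ext i
  simp [degZ, G.deg_comp]

theorem degZ_id (a : V) : G.degZ (𝟙 a) = 0 := by
  ext i
  simp [degZ, G.deg_id]

theorem degZ_injective {a b a' b' : V} {la : a ⟶ b} {mu : a' ⟶ b'} :
    G.degZ la = G.degZ mu ↔ G.deg la = G.deg mu := by
  simp [degZ, funext_iff]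

variable (G F) in
/-- The operator of a path on functions on the infinite path space. -/
noncomputable def repS {a b : V} (la : a ⟶ b) : Module.End 𝓛 (G.PathModule F) :=
  weight F (G.degZ la) • (push la ∘ₗ pull (𝟙 a))

variable (G F) in
/-- The operator of a ghost path on functions on the infinite path space. -/
noncomputable def repSg {a b : V} (la : a ⟶ b) : Module.End 𝓛 (G.PathModule F) :=
  weight F (-G.degZ la) • (push (𝟙 a) ∘ₗ pull la)

theorem repP_apply (v : V) (g : G.PathModule F) : repP G F v g = push (𝟙 v) (pull (𝟙 v) g) := rfl

theorem repS_apply {a b : V} (la : a ⟶ b) (g : G.PathModule F) :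
    repS G F la g = weight F (G.degZ la) • push la (pull (𝟙 a) g) := rfl

theorem repSg_apply {a b : V} (la : a ⟶ b) (g : G.PathModule F) :
    repSg G F la g = weight F (-G.degZ la) • push (𝟙 a) (pull la g) := rfl

theorem isKPFamily_rep [G.RowFinite] : G.IsKPFamily (repP G F) (repS G F) (repSg G F) where
  S_id v := by
    ext1 g
    rw [repS_apply, degZ_id, weight_zero, one_smul, repP_apply]
  Sg_id v := by
    ext1 g
    rw [repSg_apply, degZ_id, neg_zero, weight_zero, one_smul, repP_apply]
  kp1_self v := by
    ext1 g
    rw [Module.End.mul_apply, repP_apply, repP_apply, pull_push_self]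
  kp1_ne v v' h := by
    ext1 g
    rw [Module.End.mul_apply, repP_apply, repP_apply,
      pull_push_ne _ _ ((G.deg_id v).trans (G.deg_id v').symm) (fun h' => h ?_), map_zero,
      LinearMap.zero_apply]
    exact congrArg (fun f : Arrow V => f.left) h'
  kp2_path mu la := by
    ext1 g
    rw [Module.End.mul_apply, repS_apply, repS_apply, repS_apply, map_smul, map_smul,
      push_pull_id_push, smul_smul, weight_add, degZ_comp]
  kp2_ghost mu la := by
    ext1 g
    rw [Module.End.mul_apply, repSg_apply, repSg_apply, repSg_apply, map_smul, map_smul,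
      pull_push_id_pull, smul_smul, weight_add, degZ_comp, neg_add_rev]
  kp2_range_path la := by
    ext1 g
    rw [Module.End.mul_apply, repP_apply, repS_apply, map_smul, map_smul, push_pull_id_push,
      Category.comp_id]
  kp2_path_source la := by
    ext1 g
    rw [Module.End.mul_apply, repP_apply, repS_apply, repS_apply, pull_push_self]
  kp2_source_ghost la := by
    ext1 g
    rw [Module.End.mul_apply, repP_apply, repSg_apply, map_smul, map_smul, pull_push_self]
  kp2_ghost_range la := by
    ext1 g
    rw [Module.End.mul_apply, repP_apply, repSg_apply, repSg_apply, pull_push_id_pull,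
      Category.comp_id]
  kp3_self la := by
    ext1 g
    rw [Module.End.mul_apply, repP_apply, repSg_apply, repS_apply, map_smul, map_smul,
      pull_push_self, smul_smul, weight_add, neg_add_cancel, weight_zero, one_smul]
  kp3_ne la mu hd h := by
    ext1 g
    rw [Module.End.mul_apply, repSg_apply, repS_apply, map_smul, map_smul,
      pull_push_ne la mu hd h, map_zero, smul_zero, smul_zero, LinearMap.zero_apply]
  kp4 v n := by
    ext1 g
    have h1 : ∀ α : G.PathsInto v n, (repS G F α.hom * repSg G F α.hom) g =
        push α.hom (pull α.hom g) := fun α => by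
      rw [Module.End.mul_apply, repSg_apply, repS_apply, map_smul, map_smul,
        pull_push_self, smul_smul, weight_add, add_neg_cancel, weight_zero, one_smul]
    rw [LinearMap.sum_apply]
    simp only [h1]
    funext y
    rw [Finset.sum_apply, repP_apply]
    obtain ⟨u, y⟩ := y
    by_cases hu : u = v
    · subst hu
      obtain ⟨x, hx⟩ := y.exists_prepend n
      have hx' : concat (y.seg n).hom x = ⟨u, y⟩ := by rw [concat, hx]
      -- An infinite path into `v` lies in the image of exactly one path of degree `n`, its own
      -- initial segment, so one summand survives.
      rw [Finset.sum_eq_single (y.seg n), ← hx', push_apply, hx', ← concat_id, push_apply,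
        pull_apply, pull_apply, concat_id, hx']
      · intro α _ hα
        refine push_apply_of_notMem _ _ fun z hz => hα ?_
        have h2 : z.prepend α.hom = y := eq_of_heq (Sigma.mk.inj_iff.1 hz).2
        rw [← h2, z.seg_prepend_self α.hom α.deg_hom]
        rfl
      · intro h
        exact absurd (Finset.mem_univ _) h
    · rw [push_apply_of_notMem _ _ (fun x hx => hu (Sigma.mk.inj_iff.1 hx).1.symm)]
      exact (Finset.sum_eq_zero fun α _ => push_apply_of_notMem _ _
        (fun x hx => hu (Sigma.mk.inj_iff.1 hx).1.symm)).symm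

variable (G F) in
/-- The infinite path representation of the Kumjian-Pask algebra. -/
noncomputable def rep [G.RowFinite] : G.KPAlgebra F →ₙₐ[F] Module.End 𝓛 (G.PathModule F) :=
  (G.kp_existsUnique_hom F (isKPFamily_rep (G := G) (F := F))).choose

theorem rep_P [G.RowFinite] (v : V) : rep G F (G.kpP F v) = repP G F v :=
  (G.kp_existsUnique_hom F (isKPFamily_rep (G := G) (F := F))).choose_spec.1.1 v

theorem rep_S [G.RowFinite] {a b : V} (la : a ⟶ b) : rep G F (G.kpS F la) = repS G F la :=
  (G.kp_existsUnique_hom F (isKPFamily_rep (G := G) (F := F))).choose_spec.1.2.1 la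

theorem rep_Sg [G.RowFinite] {a b : V} (la : a ⟶ b) : rep G F (G.kpSg F la) = repSg G F la :=
  (G.kp_existsUnique_hom F (isKPFamily_rep (G := G) (F := F))).choose_spec.1.2.2 la

end Representation

/-! ### The spanning set of the Kumjian-Pask algebra -/

section Spanning

namespace IsKPFamily

variable {G : HigherRankGraph k V} [G.RowFinite] {A : Type x} [NonUnitalRing A] {P : V → A}
  {S Sg : ∀ {a b : V}, (a ⟶ b) → A}

theorem ghost_mul_comp (h : G.IsKPFamily P S Sg) {a b c : V} (nu : a ⟶ b) (mu : b ⟶ c) :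
    Sg mu * S (nu ≫ mu) = S nu := by
  rw [← h.kp2_path, ← mul_assoc, h.kp3_self, h.kp2_range_path]

/-- Factor `la` through its initial segment of degree `d(mu)`: either that segment is `mu` and
cancels, or `kp3_ne` applies. -/
theorem ghost_mul_path (h : G.IsKPFamily P S Sg) {a b c d : V} (mu : a ⟶ b) (la : c ⟶ d)
    (hd : G.deg mu ≤ G.deg la) :
    (∃ nu : c ⟶ a, Sg mu * S la = S nu ∧ S mu * S nu = S la) ∨ Sg mu * S la = 0 := by
  obtain ⟨e, nu, mu', rfl, h2, -⟩ := G.exists_factor_of_le la hd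
  by_cases hA : Arrow.mk mu = Arrow.mk mu'
  · obtain ⟨rfl, rfl, rfl⟩ : ∃ (h1 : a = e) (h2 : b = d), mu' = eqToHom h1.symm ≫ mu ≫ eqToHom h2 :=
      ⟨congrArg (fun f : Arrow V => f.left) hA, congrArg (fun f : Arrow V => f.right) hA, by
        cases hA; simp⟩
    refine Or.inl ⟨nu, ?_, ?_⟩
    · simpa using h.ghost_mul_comp nu mu
    · simpa using h.kp2_path nu mu
  · right
    rw [← h.kp2_path, ← mul_assoc, h.kp3_ne mu mu' h2.symm hA, zero_mul]

theorem path_mul_path_ne (h : G.IsKPFamily P S Sg) {a b c d : V} (mu : a ⟶ b) (la : c ⟶ d)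
    (hd : a ≠ d) :
    S mu * S la = 0 := by
  rw [← h.kp2_path_source mu, ← h.kp2_range_path la, mul_assoc, ← mul_assoc (P a),
    h.kp1_ne _ _ hd, zero_mul, mul_zero]

theorem path_eq_sum (h : G.IsKPFamily P S Sg) {a b : V} (la : a ⟶ b) (n : Fin k → ℕ) :
    S la = ∑ τ : G.PathsInto a n, S (τ.hom ≫ la) * Sg τ.hom := by
  conv_lhs => rw [← h.kp2_path_source la, h.kp4 a n, Finset.mul_sum]
  refine Finset.sum_congr rfl fun τ _ => ?_
  rw [← mul_assoc, h.kp2_path]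

theorem range_projection_mul_path (h : G.IsKPFamily P S Sg)
    {a b c d : V} (mu : a ⟶ b) (la : c ⟶ d) (hd : G.deg mu ≤ G.deg la) :
    S mu * Sg mu * S la = S la ∨ S mu * Sg mu * S la = 0 := by
  rw [mul_assoc]
  rcases h.ghost_mul_path mu la hd with ⟨nu, h1, h2⟩ | h1
  · exact Or.inl (by rw [h1, h2])
  · exact Or.inr (by rw [h1, mul_zero])

end IsKPFamily

variable {G : HigherRankGraph k V} [G.RowFinite] {F : Type x} [CommRing F]

theorem kp_induction {p : G.KPAlgebra F → Prop} (hP : ∀ v, p (G.kpP F v))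
    (hS : ∀ {a b : V} (la : a ⟶ b), p (G.kpS F la))
    (hSg : ∀ {a b : V} (la : a ⟶ b), p (G.kpSg F la)) (zero : p 0)
    (add : ∀ y z, p y → p z → p (y + z)) (mul : ∀ y z, p y → p z → p (y * z))
    (smul : ∀ (r : F) y, p y → p (r • y)) (y : G.KPAlgebra F) : p y := by
  obtain ⟨y, hy⟩ := y
  induction hy using NonUnitalAlgebra.adjoin_induction with
  | mem z hz =>
    obtain ⟨g, rfl⟩ := hz
    cases g with
    | vertex v => exact hP v
    | path la => exact hS la
    | ghost la => exact hSg la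
  | add y z _ _ h1 h2 => exact add _ _ h1 h2
  | zero => exact zero
  | mul y z _ _ h1 h2 => exact mul _ _ h1 h2
  | smul r y _ h1 => exact smul r _ h1

variable (G F) in
/-- The span of the elements `s_λ s_{μ*}`. -/
def pathGhostSpan : Submodule F (G.KPAlgebra F) :=
  Submodule.span F {y | ∃ (a b c : V) (la : a ⟶ b) (mu : a ⟶ c), y = G.kpS F la * G.kpSg F mu}

theorem path_mul_ghost_mem {a b c : V} (la : a ⟶ b) (mu : a ⟶ c) :
    G.kpS F la * G.kpSg F mu ∈ G.pathGhostSpan F :=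
  Submodule.subset_span ⟨a, b, c, la, mu, rfl⟩

theorem mul_mem_pathGhostSpan (y z : G.KPAlgebra F) (hz : z ∈ G.pathGhostSpan F) :
    y * z ∈ G.pathGhostSpan F := by
  have h := G.kp_isKPFamily F
  have red : ∀ y : G.KPAlgebra F,
      (∀ {a b c : V} (la : a ⟶ b) (mu : a ⟶ c),
        y * (G.kpS F la * G.kpSg F mu) ∈ G.pathGhostSpan F) →
      ∀ z ∈ G.pathGhostSpan F, y * z ∈ G.pathGhostSpan F := by
    intro y hy z hz
    induction hz using Submodule.span_induction with
    | mem z hz =>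
      obtain ⟨a, b, c, la, mu, rfl⟩ := hz
      exact hy la mu
    | zero => rw [mul_zero]; exact zero_mem _
    | add z z' _ _ h1 h2 => rw [mul_add]; exact add_mem h1 h2
    | smul r z _ h1 => rw [mul_smul_comm]; exact Submodule.smul_mem _ _ h1
  have hS : ∀ {a b : V} (nu : a ⟶ b), ∀ z ∈ G.pathGhostSpan F,
      G.kpS F nu * z ∈ G.pathGhostSpan F := by
    intro a b nu
    refine red _ fun {a' b' c'} la mu => ?_
    by_cases hb : a = b'
    · subst hb
      rw [← mul_assoc, h.kp2_path]
      exact path_mul_ghost_mem _ _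
    · rw [← mul_assoc, h.path_mul_path_ne nu la hb, zero_mul]
      exact zero_mem _
  induction y using kp_induction generalizing z with
  | hP v => rw [← h.S_id]; exact hS _ z hz
  | hS la => exact hS la z hz
  | @hSg a b nu =>
    refine red _ (fun {a' b' c'} la mu => ?_) z hz
    -- Lengthening `la` by `d(nu)` through `kp4` at its source makes it long enough to absorb the
    -- ghost path `nu`.
    rw [h.path_eq_sum la (G.deg nu), Finset.sum_mul, Finset.mul_sum]
    refine sum_mem fun τ _ => ?_
    rw [mul_assoc, h.kp2_ghost, ← mul_assoc]
    rcases h.ghost_mul_path nu (τ.hom ≫ la) (by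
      rw [G.deg_comp, τ.deg_hom]; exact le_add_self) with ⟨ξ, h1, -⟩ | h1
    · rw [h1]
      exact path_mul_ghost_mem _ _
    · rw [h1, zero_mul]
      exact zero_mem _
  | zero => rw [zero_mul]; exact zero_mem _
  | add y y' h1 h2 => rw [add_mul]; exact add_mem (h1 z hz) (h2 z hz)
  | mul y y' h1 h2 => rw [mul_assoc]; exact h1 _ (h2 z hz)
  | smul r y h1 => rw [smul_mul_assoc]; exact Submodule.smul_mem _ _ (h1 z hz)

theorem mem_pathGhostSpan (y : G.KPAlgebra F) : y ∈ G.pathGhostSpan F := by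
  have h := G.kp_isKPFamily F
  have hP : ∀ v, G.kpP F v ∈ G.pathGhostSpan F := fun v => by
    have := path_mul_ghost_mem (G := G) (F := F) (𝟙 v) (𝟙 v)
    rwa [h.S_id, h.Sg_id, h.kp1_self] at this
  induction y using kp_induction with
  | hP v => exact hP v
  | hS la => rw [← h.kp2_path_source]; exact mul_mem_pathGhostSpan _ _ (hP _)
  | hSg la => rw [← h.kp2_ghost_range]; exact mul_mem_pathGhostSpan _ _ (hP _)
  | zero => exact zero_mem _
  | add y z h1 h2 => exact add_mem h1 h2
  | mul y z h1 h2 => exact mul_mem_pathGhostSpan _ _ h2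
  | smul r y h1 => exact Submodule.smul_mem _ _ h1

theorem kp_span_induction {p : G.KPAlgebra F → Prop}
    (mem : ∀ {a b c : V} (la : a ⟶ b) (mu : a ⟶ c), p (G.kpS F la * G.kpSg F mu)) (zero : p 0)
    (add : ∀ y z, p y → p z → p (y + z)) (smul : ∀ (r : F) y, p y → p (r • y))
    (y : G.KPAlgebra F) : p y := by
  have hy := mem_pathGhostSpan y
  induction hy using Submodule.span_induction with
  | mem z hz =>
    obtain ⟨a, b, c, la, mu, rfl⟩ := hz
    exact mem la mu
  | zero => exact zero
  | add z z' _ _ h1 h2 => exact add z z' h1 h2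
  | smul r z _ h1 => exact smul r z h1

theorem kpP_mul_ne {v v' : V} (hv : v ≠ v') {y : G.KPAlgebra F} (hy : G.kpP F v' * y = y) :
    G.kpP F v * y = 0 := by
  rw [← hy, ← mul_assoc, (G.kp_isKPFamily F).kp1_ne v v' hv, zero_mul]

theorem mul_kpP_ne {v v' : V} (hv : v ≠ v') {y : G.KPAlgebra F} (hy : y * G.kpP F v = y) :
    y * G.kpP F v' = 0 := by
  rw [← hy, mul_assoc, (G.kp_isKPFamily F).kp1_ne v v' hv, mul_zero]

/-- Local units. Quantifying over all larger finite sets lets two summands share one unit. -/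
theorem exists_sum_mul_eq (y : G.KPAlgebra F) :
    ∃ E : Finset V, ∀ E', E ⊆ E' → (∑ v ∈ E', G.kpP F v) * y = y := by
  classical
  have h := G.kp_isKPFamily F
  induction y using kp_span_induction with
  | @mem a b c la mu =>
    refine ⟨{b}, fun E' hE' => ?_⟩
    rw [← mul_assoc, Finset.sum_mul, Finset.sum_eq_single b, h.kp2_range_path]
    · exact fun v _ hv => kpP_mul_ne hv (h.kp2_range_path la)
    · exact fun hb => absurd (hE' (Finset.mem_singleton_self b)) hb
  | zero => exact ⟨∅, fun _ _ => mul_zero _⟩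
  | add y z h1 h2 =>
    obtain ⟨E, h1⟩ := h1
    obtain ⟨E', h2⟩ := h2
    refine ⟨E ∪ E', fun L hL => ?_⟩
    rw [mul_add, h1 L (Finset.union_subset_left hL), h2 L (Finset.union_subset_right hL)]
  | smul r y h1 =>
    obtain ⟨E, h1⟩ := h1
    exact ⟨E, fun L hL => by rw [mul_smul_comm, h1 L hL]⟩

theorem exists_mul_sum_eq (y : G.KPAlgebra F) :
    ∃ E : Finset V, ∀ E', E ⊆ E' → y * (∑ v ∈ E', G.kpP F v) = y := by
  classical
  have h := G.kp_isKPFamily F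
  induction y using kp_span_induction with
  | @mem a b c la mu =>
    refine ⟨{c}, fun E' hE' => ?_⟩
    rw [mul_assoc, Finset.mul_sum, Finset.sum_eq_single c, h.kp2_ghost_range]
    · exact fun v _ hv => mul_kpP_ne hv.symm (h.kp2_ghost_range mu)
    · exact fun hb => absurd (hE' (Finset.mem_singleton_self c)) hb
  | zero => exact ⟨∅, fun _ _ => zero_mul _⟩
  | add y z h1 h2 =>
    obtain ⟨E, h1⟩ := h1
    obtain ⟨E', h2⟩ := h2
    refine ⟨E ∪ E', fun L hL => ?_⟩
    rw [add_mul, h1 L (Finset.union_subset_left hL), h2 L (Finset.union_subset_right hL)]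
  | smul r y h1 =>
    obtain ⟨E, h1⟩ := h1
    exact ⟨E, fun L hL => by rw [smul_mul_assoc, h1 L hL]⟩

theorem exists_left_unit (y : G.KPAlgebra F) : ∃ e, e * y = y := by
  obtain ⟨E, hE⟩ := exists_sum_mul_eq y
  exact ⟨_, hE E le_rfl⟩

theorem exists_right_unit (y : G.KPAlgebra F) : ∃ e, y * e = y := by
  obtain ⟨E, hE⟩ := exists_mul_sum_eq y
  exact ⟨_, hE E le_rfl⟩

theorem exists_mul_path_ne_zero {y : G.KPAlgebra F} (hy : y ≠ 0) :
    ∃ v, ∀ n, ∃ μ : G.PathsInto v n, y * G.kpS F μ.hom ≠ 0 := by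
  by_contra! hc
  refine hy ?_
  obtain ⟨E, hE⟩ := exists_mul_sum_eq y
  rw [← hE E le_rfl, Finset.mul_sum]
  refine Finset.sum_eq_zero fun v _ => ?_
  obtain ⟨n, hn⟩ := hc v
  rw [(G.kp_isKPFamily F).kp4 v n, Finset.mul_sum]
  refine Finset.sum_eq_zero fun μ _ => ?_
  rw [← mul_assoc, hn μ, zero_mul]

variable (G F) in
/-- Linear combinations of the paths with source `a`. -/
noncomputable def pathSum (a : V) : ((Σ b : V, (a ⟶ b)) →₀ F) →ₗ[F] G.KPAlgebra F :=
  Finsupp.linearCombination F fun p => G.kpS F p.2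

theorem pathSum_single {a b : V} (la : a ⟶ b) (r : F) :
    pathSum G F a (Finsupp.single ⟨b, la⟩ r) = r • G.kpS F la :=
  Finsupp.linearCombination_single _ _ _

/-- Once `d(mu)` dominates the degrees of all ghost paths in `y`, each of them is absorbed into `mu`
or kills the term. -/
theorem exists_degree_mul_path_eq_pathSum (y : G.KPAlgebra F) :
    ∃ n : Fin k → ℕ, ∀ m, n ≤ m → ∀ {a v : V} (mu : a ⟶ v), G.deg mu = m →
      ∃ c, y * G.kpS F mu = pathSum G F a c := by
  have h := G.kp_isKPFamily F
  induction y using kp_span_induction with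
  | @mem a b c la tau =>
    refine ⟨G.deg tau, fun m hm a' v mu hmu => ?_⟩
    rw [mul_assoc]
    rcases h.ghost_mul_path tau mu (hm.trans hmu.ge) with ⟨nu, h1, -⟩ | h1
    · exact ⟨Finsupp.single ⟨b, nu ≫ la⟩ 1, by rw [h1, h.kp2_path, pathSum_single, one_smul]⟩
    · exact ⟨0, by rw [h1, mul_zero, map_zero]⟩
  | zero => exact ⟨0, fun m _ a v mu _ => ⟨0, by rw [zero_mul, map_zero]⟩⟩
  | add y z h1 h2 =>
    obtain ⟨n, h1⟩ := h1
    obtain ⟨n', h2⟩ := h2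
    refine ⟨n ⊔ n', fun m hm a v mu hmu => ?_⟩
    obtain ⟨c, hc⟩ := h1 m (le_sup_left.trans hm) mu hmu
    obtain ⟨c', hc'⟩ := h2 m (le_sup_right.trans hm) mu hmu
    exact ⟨c + c', by rw [add_mul, hc, hc', map_add]⟩
  | smul r y h1 =>
    obtain ⟨n, h1⟩ := h1
    refine ⟨n, fun m hm a v mu hmu => ?_⟩
    obtain ⟨c, hc⟩ := h1 m hm mu hmu
    exact ⟨r • c, by rw [smul_mul_assoc, hc, map_smul]⟩

theorem exists_mul_path_eq_pathSum {y : G.KPAlgebra F} (hy : y ≠ 0) :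
    ∃ (a v : V) (mu : a ⟶ v) (c : (Σ b : V, (a ⟶ b)) →₀ F),
      y * G.kpS F mu = pathSum G F a c ∧ y * G.kpS F mu ≠ 0 := by
  obtain ⟨v, hv⟩ := exists_mul_path_ne_zero hy
  obtain ⟨n, hn⟩ := exists_degree_mul_path_eq_pathSum y
  obtain ⟨μ, hμ⟩ := hv n
  obtain ⟨c, hc⟩ := hn n le_rfl μ.hom μ.deg_hom
  exact ⟨_, v, μ.hom, c, hc, hμ⟩

end Spanning

/-! ### Faithfulness of the infinite path representation -/

section Faithful

variable {G : HigherRankGraph k V} {F : Type x} [Field F]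

local notation "𝓛" => AddMonoidAlgebra F (Fin k → ℤ)

open Classical in
variable (F) in
/-- The indicator function of an infinite path. -/
noncomputable def delta (y : Σ v, G.InfPath v) : G.PathModule F := Pi.single y 1

theorem delta_self (y : Σ v, G.InfPath v) : delta F y y = 1 := by
  classical
  exact Pi.single_eq_same _ _

theorem delta_ne {y z : Σ v, G.InfPath v} (h : z ≠ y) : delta F y z = 0 := by
  classical
  exact Pi.single_eq_of_ne h _

theorem weight_ne_zero (n : Fin k → ℤ) : weight F n ≠ 0 := by
  simp [weight]

theorem smul_delta_ne_zero {q : 𝓛} (hq : q ≠ 0) (y : Σ v, G.InfPath v) : q • delta F y ≠ 0 :=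
  fun h => hq <| by
    have := congrFun h y
    rwa [Pi.smul_apply, delta_self, smul_eq_mul, mul_one] at this

theorem push_pull_delta {a b c : V} (la : a ⟶ b) (mu : a ⟶ c) (x : G.InfPath a) :
    push mu (pull la (delta F (concat la x))) = delta F (concat mu x) := by
  funext y
  by_cases h : ∃ z, concat mu z = y
  · obtain ⟨z, rfl⟩ := h
    rw [push_apply, pull_apply]
    by_cases hz : z = x
    · rw [hz, delta_self, delta_self]
    · rw [delta_ne ((concat_injective la).ne hz), delta_ne ((concat_injective mu).ne hz)]
  · push Not at h
    rw [push_apply_of_notMem _ _ h, delta_ne (h x).symm]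

theorem repS_delta {a b : V} (la : a ⟶ b) (x : G.InfPath a) :
    repS G F la (delta F ⟨a, x⟩) = weight F (G.degZ la) • delta F (concat la x) := by
  rw [repS_apply, ← concat_id, push_pull_delta]

theorem repSg_delta {a b : V} (la : a ⟶ b) (x : G.InfPath a) :
    repSg G F la (delta F (concat la x)) = weight F (-G.degZ la) • delta F ⟨a, x⟩ := by
  rw [repSg_apply, push_pull_delta, concat_id]

theorem repSg_delta_of_ne {a b : V} (la : a ⟶ b) {y : Σ v, G.InfPath v}
    (h : ∀ x, concat la x ≠ y) : repSg G F la (delta F y) = 0 := by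
  have : pull la (delta F y) = 0 := funext fun x => delta_ne (h x)
  rw [repSg_apply, this, map_zero, smul_zero]

variable [G.RowFinite]

theorem rep_projection_delta {a b : V} (la : a ⟶ b) (x : G.InfPath a) :
    rep G F (G.kpS F la * G.kpSg F la) (delta F (concat la x)) = delta F (concat la x) := by
  rw [map_mul, rep_S, rep_Sg, Module.End.mul_apply, repSg_delta, map_smul, repS_delta, smul_smul,
    weight_add, neg_add_cancel, weight_zero, one_smul]

theorem rep_projection_delta_of_ne {a b : V} (la : a ⟶ b) {y : Σ v, G.InfPath v}
    (h : ∀ x, concat la x ≠ y) :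
    rep G F (G.kpS F la * G.kpSg F la) (delta F y) = 0 := by
  rw [map_mul, rep_S, rep_Sg, Module.End.mul_apply, repSg_delta_of_ne la h, map_zero]

theorem rep_S_delta {a b : V} (la : a ⟶ b) (x : G.InfPath a) :
    rep G F (G.kpS F la) (delta F ⟨a, x⟩) = weight F (G.degZ la) • delta F (concat la x) := by
  rw [rep_S, repS_delta]

theorem rep_P_delta {a : V} (x : G.InfPath a) :
    rep G F (G.kpP F a) (delta F ⟨a, x⟩) = delta F ⟨a, x⟩ := by
  rw [rep_P, repP_apply, ← concat_id, push_pull_delta]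

theorem rep_pathSum_delta {a : V} (c : (Σ b : V, (a ⟶ b)) →₀ F) (x : G.InfPath a) :
    rep G F (pathSum G F a c) (delta F ⟨a, x⟩) =
      c.sum fun p r => r • (weight F (G.degZ p.2) • delta F (concat p.2 x)) := by
  rw [pathSum, Finsupp.linearCombination_apply, Finsupp.sum, map_sum, LinearMap.sum_apply]
  refine Finset.sum_congr rfl fun p _ => ?_
  rw [map_smul, LinearMap.smul_apply, rep_S_delta]

/-- Distinct paths that send `x` to the same infinite path have different degrees, hence contribute
different monomials there. The coefficient of exponent `d(p)` at `p x` is therefore `c p`. This is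
the purpose of the Laurent coefficients: no aperiodicity of the graph is needed. -/
theorem pathSum_rep_injective {a : V} {c : (Σ b : V, (a ⟶ b)) →₀ F} (x : G.InfPath a)
    (h : rep G F (pathSum G F a c) (delta F ⟨a, x⟩) = 0) : c = 0 := by
  rw [rep_pathSum_delta] at h
  ext p
  by_contra hp
  have h1 := congrArg (fun q : 𝓛 => q.coeff (G.degZ p.2)) (congrFun h (concat p.2 x))
  simp only [Finsupp.sum, Finset.sum_apply, AddMonoidAlgebra.coeff_sum,
    Finsupp.finsetSum_apply] at h1
  rw [Finset.sum_eq_single p] at h1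
  · simp [delta_self, weight] at h1
    exact hp h1
  · intro q _ hq
    simp only [Pi.smul_apply]
    by_cases hx : concat p.2 x = concat q.2 x
    · rw [hx, delta_self, smul_eq_mul, mul_one]
      have hd : G.degZ q.2 ≠ G.degZ p.2 := fun hd => by
        have h2 := InfPath.arrow_eq_of_prepend_eq hx.symm (degZ_injective.1 hd)
        obtain ⟨b, la⟩ := p
        obtain ⟨b', mu⟩ := q
        apply hq
        cases h2
        rfl
      rw [weight, AddMonoidAlgebra.smul_single, AddMonoidAlgebra.coeff_single,
        Finsupp.single_eq_of_ne hd.symm]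
    · rw [delta_ne hx, smul_zero, smul_zero]
      rfl
  · intro h2
    exact absurd (Finsupp.notMem_support_iff.1 h2) hp

variable [G.NoSources]

theorem rep_injective {y : G.KPAlgebra F} (h : rep G F y = 0) : y = 0 := by
  by_contra hy
  obtain ⟨a, v, mu, c, h1, h2⟩ := exists_mul_path_eq_pathSum hy
  refine h2 ?_
  obtain ⟨x⟩ : Nonempty (G.InfPath a) := inferInstance
  rw [h1, pathSum_rep_injective (c := c) x, map_zero]
  rw [← h1, map_mul, h, zero_mul, LinearMap.zero_apply]

theorem kpS_ne_zero {a b : V} (la : a ⟶ b) : G.kpS F la ≠ 0 := by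
  intro h
  obtain ⟨x⟩ : Nonempty (G.InfPath a) := inferInstance
  have := rep_S_delta (F := F) la x
  rw [h, map_zero, LinearMap.zero_apply] at this
  exact smul_delta_ne_zero (weight_ne_zero _) _ this.symm

theorem kpP_ne_zero (v : V) : G.kpP F v ≠ 0 := by
  rw [← (G.kp_isKPFamily F).S_id]
  exact kpS_ne_zero _

end Faithful

/-! ### Reduction to path combinations that act by a scalar at each infinite path -/

section Reduction

variable {G : HigherRankGraph k V} {F : Type x} [Field F]

theorem exists_separating {y y' : Σ v, G.InfPath v} (h : y ≠ y') :
    ∃ (a b : V) (η : a ⟶ b), (∃ x, concat η x = y) ∧ ∀ x, concat η x ≠ y' := by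
  obtain ⟨v, y⟩ := y
  obtain ⟨v', y'⟩ := y'
  by_cases hv : v = v'
  · subst hv
    obtain ⟨n, hn⟩ : ∃ n, y.seg n ≠ y'.seg n := by
      by_contra! hc
      exact h (by rw [InfPath.ext (funext hc)])
    obtain ⟨x, hx⟩ := y.exists_prepend n
    refine ⟨_, v, (y.seg n).hom, ⟨x, by rw [concat, hx]⟩, fun x' hx' => hn ?_⟩
    have h1 : x'.prepend (y.seg n).hom = y' := eq_of_heq (Sigma.mk.inj_iff.1 hx').2
    rw [← h1, x'.seg_prepend_self _ (y.seg n).deg_hom]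
    rfl
  · exact ⟨v, v, 𝟙 v, ⟨y, concat_id y⟩, fun x hx => hv (Sigma.mk.inj_iff.1 hx).1⟩

variable [G.RowFinite]

theorem pathSum_mul_path {a a' : V} (c : (Σ b : V, (a ⟶ b)) →₀ F) (ξ : a' ⟶ a) :
    pathSum G F a c * G.kpS F ξ =
      pathSum G F a' (c.mapDomain fun p => ⟨p.1, ξ ≫ p.2⟩) := by
  rw [pathSum, pathSum, Finsupp.linearCombination_mapDomain, Finsupp.linearCombination_apply,
    Finsupp.linearCombination_apply, Finsupp.sum, Finsupp.sum, Finset.sum_mul]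
  refine Finset.sum_congr rfl fun p _ => ?_
  rw [smul_mul_assoc, (G.kp_isKPFamily F).kp2_path]
  rfl

theorem comp_path_injective (G : HigherRankGraph k V) {a a' : V} (ξ : a' ⟶ a) :
    Function.Injective
      (fun p : Σ b : V, (a ⟶ b) => (⟨p.1, ξ ≫ p.2⟩ : Σ b : V, (a' ⟶ b))) := by
  rintro ⟨b, la⟩ ⟨b', mu⟩ h
  obtain ⟨h1, h2⟩ := Sigma.mk.inj_iff.1 h
  change b = b' at h1
  subst h1
  have h3 : la = mu := G.comp_left_cancel (eq_of_heq h2)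
  rw [h3]

/-- The product is `s_la` or `0`, and evaluation at the indicator of `x` decides which. -/
theorem projection_mul_path_of_mem {a b c d : V} (η : a ⟶ b) (la : c ⟶ d) (x : G.InfPath c)
    (hd : G.deg η ≤ G.deg la) (h : ∃ z, concat η z = concat la x) :
    G.kpS F η * G.kpSg F η * G.kpS F la = G.kpS F la := by
  refine ((G.kp_isKPFamily F).range_projection_mul_path η la hd).resolve_right fun h0 => ?_
  obtain ⟨z, hz⟩ := h
  have h1 := congrArg (fun y => rep G F y (delta F ⟨c, x⟩)) h0
  simp only [map_mul _ (_ * _), Module.End.mul_apply, rep_S_delta, map_smul, map_zero] at h1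
  rw [← hz, rep_projection_delta, LinearMap.zero_apply] at h1
  exact smul_delta_ne_zero (weight_ne_zero _) _ h1

theorem projection_mul_path_of_notMem {a b c d : V} (η : a ⟶ b) (la : c ⟶ d) (x : G.InfPath c)
    (hd : G.deg η ≤ G.deg la) (h : ∀ z, concat η z ≠ concat la x) :
    G.kpS F η * G.kpSg F η * G.kpS F la = 0 := by
  refine ((G.kp_isKPFamily F).range_projection_mul_path η la hd).resolve_left fun h0 => ?_
  have h1 := congrArg (fun y => rep G F y (delta F ⟨c, x⟩)) h0
  simp only [map_mul _ (_ * _), Module.End.mul_apply, rep_S_delta, map_smul] at h1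
  rw [rep_projection_delta_of_ne η h, smul_zero] at h1
  exact smul_delta_ne_zero (weight_ne_zero _) _ h1.symm

/-- A range projection `s_η s_{η*}` with `p x` in the range of `η` and `q x` outside it keeps the
term of `p` and removes that of `q`. Multiplying first on the right by an initial segment `ξ` of `x`
of degree `d(η)` makes every path long enough to be either kept or killed whole. -/
theorem exists_smaller_pathSum {Q : G.KPAlgebra F → Prop}
    (hl : ∀ a y, Q y → a * y ≠ 0 → Q (a * y)) (hr : ∀ y b, Q y → y * b ≠ 0 → Q (y * b))
    {a : V} {c : (Σ b : V, (a ⟶ b)) →₀ F} (hQ : Q (pathSum G F a c)) {x : G.InfPath a}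
    {p q : Σ b : V, (a ⟶ b)} (hp : p ∈ c.support) (hq : q ∈ c.support)
    (hpq : concat p.2 x ≠ concat q.2 x) :
    ∃ (a' : V) (c' : (Σ b : V, (a' ⟶ b)) →₀ F), c' ≠ 0 ∧ Q (pathSum G F a' c') ∧
      c'.support.card < c.support.card := by
  classical
  obtain ⟨e, f, η, hz, hη⟩ := exists_separating hpq
  obtain ⟨a', ξ, x', rfl, hd⟩ : ∃ (a' : V) (ξ : a' ⟶ a) (x' : G.InfPath a'),
      x'.prepend ξ = x ∧ G.deg ξ = G.deg η := by
    obtain ⟨x', hx'⟩ := x.exists_prepend (G.deg η)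
    exact ⟨_, _, x', hx', PathsInto.deg_hom _⟩
  have hle : ∀ s : Σ b : V, (a ⟶ b), G.deg η ≤ G.deg (ξ ≫ s.2) := fun s => by
    rw [G.deg_comp, hd]
    exact le_add_self
  let T : (Σ b : V, (a ⟶ b)) → Prop := fun s => ∃ z, concat η z = concat s.2 (x'.prepend ξ)
  have h1 : G.kpS F η * G.kpSg F η * (pathSum G F a (c.filter T) * G.kpS F ξ) =
      pathSum G F a (c.filter T) * G.kpS F ξ := by
    rw [pathSum, Finsupp.linearCombination_apply, Finsupp.sum, Finset.sum_mul, Finset.mul_sum]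
    refine Finset.sum_congr rfl fun s hs => ?_
    rw [smul_mul_assoc, mul_smul_comm, (G.kp_isKPFamily F).kp2_path,
      projection_mul_path_of_mem η (ξ ≫ s.2) x' (hle s)]
    rw [concat_comp]
    rw [Finsupp.support_filter, Finset.mem_filter] at hs
    exact hs.2
  have h2 : G.kpS F η * G.kpSg F η * (pathSum G F a (c.filter fun s => ¬ T s) * G.kpS F ξ) = 0 := by
    rw [pathSum, Finsupp.linearCombination_apply, Finsupp.sum, Finset.sum_mul, Finset.mul_sum]
    refine Finset.sum_eq_zero fun s hs => ?_
    rw [smul_mul_assoc, mul_smul_comm, (G.kp_isKPFamily F).kp2_path,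
      projection_mul_path_of_notMem η (ξ ≫ s.2) x' (hle s), smul_zero]
    rw [concat_comp]
    rw [Finsupp.support_filter, Finset.mem_filter] at hs
    exact fun z hz => hs.2 ⟨z, hz⟩
  have h3 : G.kpS F η * G.kpSg F η * pathSum G F a c * G.kpS F ξ =
      pathSum G F a' ((c.filter T).mapDomain fun p => ⟨p.1, ξ ≫ p.2⟩) := by
    rw [← pathSum_mul_path, ← h1, mul_assoc]
    conv_lhs => rw [← Finsupp.filter_add_filter_not (p := T) (f := c), map_add, add_mul, mul_add, h2,
      add_zero]
  have h4 : (c.filter T).mapDomain (fun p => (⟨p.1, ξ ≫ p.2⟩ : Σ b : V, (a' ⟶ b))) ≠ 0 := by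
    intro h0
    have h5 := Finsupp.mapDomain_injective (comp_path_injective G ξ)
      (h0.trans Finsupp.mapDomain_zero.symm)
    have h6 : p ∈ (c.filter T).support := by
      rw [Finsupp.support_filter, Finset.mem_filter]
      exact ⟨hp, hz⟩
    rw [h5] at h6
    simp at h6
  have h5 : pathSum G F a' ((c.filter T).mapDomain fun p => ⟨p.1, ξ ≫ p.2⟩) ≠ 0 := fun h0 =>
    h4 (pathSum_rep_injective x' (by rw [h0, map_zero, LinearMap.zero_apply]))
  refine ⟨a', _, h4, ?_, ?_⟩
  · rw [← h3] at h5 ⊢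
    exact hr _ _ (hl _ _ hQ (left_ne_zero_of_mul h5)) h5
  · refine (Finset.card_le_card Finsupp.mapDomain_support).trans_lt
      (Finset.card_image_le.trans_lt (Finset.card_lt_card ?_))
    rw [Finsupp.support_filter, Finset.filter_ssubset]
    exact ⟨q, hq, fun ⟨z, hz⟩ => hη z hz⟩

/-- Descent on the size of the support. `Q` is any property inherited by nonzero one-sided
multiples; it is used for membership in an ideal and for minimality. -/
theorem exists_reduced_pathSum [G.NoSources] {Q : G.KPAlgebra F → Prop}
    (hl : ∀ a y, Q y → a * y ≠ 0 → Q (a * y)) (hr : ∀ y b, Q y → y * b ≠ 0 → Q (y * b))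
    {y : G.KPAlgebra F} (hy : y ≠ 0) (hQ : Q y) :
    ∃ (a : V) (c : (Σ b : V, (a ⟶ b)) →₀ F), c ≠ 0 ∧ Q (pathSum G F a c) ∧
      ∀ x : G.InfPath a, ∀ p ∈ c.support, ∀ q ∈ c.support, concat p.2 x = concat q.2 x := by
  have key : ∀ (n : ℕ) (a : V) (c : (Σ b : V, (a ⟶ b)) →₀ F), c.support.card = n → c ≠ 0 →
      Q (pathSum G F a c) → ∃ (a : V) (c : (Σ b : V, (a ⟶ b)) →₀ F), c ≠ 0 ∧
      Q (pathSum G F a c) ∧ ∀ x : G.InfPath a, ∀ p ∈ c.support, ∀ q ∈ c.support,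
        concat p.2 x = concat q.2 x := by
    intro n
    induction n using Nat.strong_induction_on with
    | _ n ih =>
      intro a c hn hc hQ
      by_contra hcon
      push Not at hcon
      obtain ⟨x, p, hp, q, hq, hpq⟩ := hcon a c hc hQ
      obtain ⟨a', c', hc', hQ', hlt⟩ := exists_smaller_pathSum hl hr hQ hp hq hpq
      obtain ⟨a'', c'', h1, h2, h3⟩ := ih _ (hn ▸ hlt) a' c' rfl hc' hQ'
      obtain ⟨x, p, hp, q, hq, hpq⟩ := hcon a'' c'' h1 h2
      exact hpq (h3 x p hp q hq)
  obtain ⟨a, v, mu, c, h1, h2⟩ := exists_mul_path_eq_pathSum hy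
  refine key _ a c rfl ?_ (h1 ▸ hr y _ hQ h2)
  rintro rfl
  exact h2 (h1.trans (map_zero _))

end Reduction
end HigherRankGraph

/-! ### Generators of minimal left ideals -/

section MinimalGenerators

variable {A : Type u} [NonUnitalRing A]

/-- A nonzero element that is a left multiple of each of its nonzero left multiples. -/
def IsMinimalGenerator (y : A) : Prop := y ≠ 0 ∧ ∀ a, a * y ≠ 0 → ∃ b, b * (a * y) = y

theorem mem_leftMultiples {y z : A} : z ∈ leftMultiples y ↔ ∃ a, a * y = z := Iff.rfl

theorem isLeftIdeal_leftMultiples (y : A) : IsLeftIdeal (leftMultiples y) := by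
  rintro a _ ⟨b, rfl⟩
  exact ⟨a * b, mul_assoc _ _ _⟩

theorem IsLeftIdeal.leftMultiples_le {L : AddSubgroup A} (hL : IsLeftIdeal L) {y : A}
    (hy : y ∈ L) : leftMultiples y ≤ L := by
  rintro _ ⟨a, rfl⟩
  exact hL a y hy

theorem IsMinimalGenerator.mul_left {y : A} (hy : IsMinimalGenerator y) {a : A} (h : a * y ≠ 0) :
    IsMinimalGenerator (a * y) := by
  refine ⟨h, fun c hc => ?_⟩
  rw [← mul_assoc] at hc
  obtain ⟨b, hb⟩ := hy.2 _ hc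
  refine ⟨a * b, ?_⟩
  rw [← mul_assoc c, mul_assoc, hb]

theorem IsMinimalGenerator.mul_right {y : A} (hy : IsMinimalGenerator y) {b : A}
    (h : y * b ≠ 0) : IsMinimalGenerator (y * b) := by
  refine ⟨h, fun a ha => ?_⟩
  rw [← mul_assoc] at ha
  obtain ⟨c, hc⟩ := hy.2 a (left_ne_zero_of_mul ha)
  refine ⟨c, ?_⟩
  rw [← mul_assoc a, ← mul_assoc, hc]

/-- Left local units put each element in its own set of left multiples, which replaces a unit of the
ring. -/
theorem isMinimalLeftIdeal_leftMultiples_iff (hA : ∀ y : A, ∃ e, e * y = y) (y : A) :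
    IsMinimalLeftIdeal (leftMultiples y) ↔ IsMinimalGenerator y := by
  constructor
  · rintro ⟨h1, h2, h3⟩
    have hy : y ≠ 0 := by
      rintro rfl
      refine h2 ((AddSubgroup.eq_bot_iff_forall _).2 ?_)
      rintro _ ⟨a, rfl⟩
      exact mul_zero a
    refine ⟨hy, fun a ha => ?_⟩
    rcases h3 _ (isLeftIdeal_leftMultiples (a * y))
      (h1.leftMultiples_le (mem_leftMultiples.2 ⟨a, rfl⟩)) with h | h
    · exact absurd ((AddSubgroup.eq_bot_iff_forall _).1 h (a * y) (hA (a * y))) ha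
    · have : y ∈ leftMultiples y := hA y
      rwa [← h] at this
  · rintro ⟨h1, h2⟩
    refine ⟨isLeftIdeal_leftMultiples y,
      fun h => h1 ((AddSubgroup.eq_bot_iff_forall _).1 h y (hA y)), fun L hL hle => ?_⟩
    refine or_iff_not_imp_left.2 fun hne => le_antisymm hle (hL.leftMultiples_le ?_)
    obtain ⟨z, hz, hz0⟩ := L.bot_or_exists_ne_zero.resolve_left hne
    obtain ⟨a, ha⟩ := hle hz
    change a * y = z at ha
    obtain ⟨b, hb⟩ := h2 a (ha ▸ hz0)
    rw [← hb, ha]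
    exact hL b _ hz

theorem IsMinimalLeftIdeal.eq_leftMultiples (hA : ∀ y : A, ∃ e, e * y = y) {L : AddSubgroup A}
    (hL : IsMinimalLeftIdeal L) {y : A} (hy : y ∈ L) (h0 : y ≠ 0) : leftMultiples y = L :=
  (hL.2.2 _ (isLeftIdeal_leftMultiples y) (hL.1.leftMultiples_le hy)).resolve_left
    fun h => h0 ((AddSubgroup.eq_bot_iff_forall _).1 h y (hA y))

theorem leftSocle_isLeftIdeal : IsLeftIdeal (leftSocle A) := by
  intro a y hy
  have : leftSocle A ≤ (leftSocle A).comap (AddMonoidHom.mulLeft a) :=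
    sSup_le fun L hL z hz => (le_sSup hL : L ≤ leftSocle A) (hL.1 a z hz)
  exact this hy

/-- Right multiplication by `b` sends an element of a minimal left ideal to zero or to another
minimal generator. -/
theorem mul_mem_leftSocle (hA : ∀ y : A, ∃ e, e * y = y) {y : A} (hy : y ∈ leftSocle A) (b : A) :
    y * b ∈ leftSocle A := by
  have : leftSocle A ≤ (leftSocle A).comap (AddMonoidHom.mulRight b) := by
    refine sSup_le fun L hL z hz => ?_
    change z * b ∈ leftSocle A
    by_cases h : z * b = 0
    · rw [h]
      exact zero_mem _
    · have h1 := hL.eq_leftMultiples hA hz (left_ne_zero_of_mul h)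
      have h2 : IsMinimalLeftIdeal (leftMultiples z) := h1 ▸ hL
      have h3 := ((isMinimalLeftIdeal_leftMultiples_iff hA z).1 h2).mul_right h
      exact (le_sSup ((isMinimalLeftIdeal_leftMultiples_iff hA _).2 h3) : _ ≤ leftSocle A)
        (hA (z * b))
  exact this hy

/-- The left socle as a two-sided ideal. -/
def leftSocleIdeal (hA : ∀ y : A, ∃ e, e * y = y) : TwoSidedIdeal A :=
  TwoSidedIdeal.mk' (leftSocle A) (zero_mem _) add_mem neg_mem
    (fun {a y} hy => leftSocle_isLeftIdeal a y hy) (fun {_ b} hy => mul_mem_leftSocle hA hy b)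

theorem mem_leftSocleIdeal (hA : ∀ y : A, ∃ e, e * y = y) {y : A} :
    y ∈ leftSocleIdeal hA ↔ y ∈ leftSocle A :=
  TwoSidedIdeal.mem_mk' _ _ _ _ _ _ _

/-- The elements `z` with `s a z = 0` for all `a` form a two-sided ideal, and symmetrically on the
left; pass to the spans one side at a time. -/
theorem TwoSidedIdeal.mul_mul_eq_zero_of_mem_span {S T : Set A}
    (h : ∀ s ∈ S, ∀ t ∈ T, ∀ a, s * a * t = 0) {y z : A} (hy : y ∈ TwoSidedIdeal.span S)
    (hz : z ∈ TwoSidedIdeal.span T) (a : A) : y * a * z = 0 := by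
  have h1 : ∀ s ∈ S, ∀ a, s * a * z = 0 := by
    intro s hs
    let I : TwoSidedIdeal A := TwoSidedIdeal.mk' {z | ∀ a, s * a * z = 0}
      (fun a => mul_zero _) (fun hx hy a => by rw [mul_add, hx, hy, add_zero])
      (fun hx a => by rw [mul_neg, hx, neg_zero])
      (fun {x y} hy a => by rw [← mul_assoc, mul_assoc s, hy])
      (fun {x y} hx a => by rw [← mul_assoc, hx, zero_mul])
    have hle : TwoSidedIdeal.span T ≤ I := TwoSidedIdeal.span_le.2 fun t ht =>
      (TwoSidedIdeal.mem_mk' _ _ _ _ _ _ _).2 fun a => h s hs t ht a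
    exact (TwoSidedIdeal.mem_mk' _ _ _ _ _ _ _).1 (hle hz)
  let J : TwoSidedIdeal A := TwoSidedIdeal.mk' {y | ∀ a, y * a * z = 0}
    (fun a => by rw [zero_mul, zero_mul]) (fun hx hy a => by rw [add_mul, add_mul, hx, hy, add_zero])
    (fun hx a => by rw [neg_mul, neg_mul, hx, neg_zero])
    (fun {x y} hy a => by rw [mul_assoc x, mul_assoc x, hy, mul_zero])
    (fun {x y} hx a => by rw [mul_assoc x, hx])
  have hle : TwoSidedIdeal.span S ≤ J := TwoSidedIdeal.span_le.2 fun s hs =>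
    (TwoSidedIdeal.mem_mk' _ _ _ _ _ _ _).2 fun a => h1 s hs a
  exact (TwoSidedIdeal.mem_mk' _ _ _ _ _ _ _).1 (hle hy) a

end MinimalGenerators

theorem TwoSidedIdeal.exists_ne_zero_of_ne_bot {A : Type*} [NonUnitalNonAssocRing A]
    {I : TwoSidedIdeal A} (h : I ≠ ⊥) :
    ∃ y ∈ I, y ≠ 0 := by
  by_contra! hc
  refine h (le_bot_iff.1 fun y hy => ?_)
  rw [hc y hy]
  exact zero_mem _

namespace HigherRankGraph

variable {k : ℕ} {V : Type u} [Category.{w} V]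

/-! ### Minimal left ideals of the Kumjian-Pask algebra -/

section Minimal

variable {G : HigherRankGraph k V} [G.RowFinite] {F : Type x} [Field F]

local notation "𝓛" => AddMonoidAlgebra F (Fin k → ℤ)

theorem rep_reduced_pathSum {a : V} {c : (Σ b : V, (a ⟶ b)) →₀ F} {x : G.InfPath a}
    {p : Σ b : V, (a ⟶ b)} (hc : c ≠ 0) (hp : ∀ q ∈ c.support, concat q.2 x = concat p.2 x) :
    ∃ q : 𝓛, q ≠ 0 ∧
      rep G F (pathSum G F a c) (delta F ⟨a, x⟩) = q • delta F (concat p.2 x) := by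
  have h : rep G F (pathSum G F a c) (delta F ⟨a, x⟩) =
      (∑ q ∈ c.support, c q • weight F (G.degZ q.2)) • delta F (concat p.2 x) := by
    rw [rep_pathSum_delta, Finsupp.sum, Finset.sum_smul]
    exact Finset.sum_congr rfl fun q hq => by rw [hp q hq, smul_assoc]
  refine ⟨_, fun h0 => hc (pathSum_rep_injective x ?_), h⟩
  rw [h, h0, zero_smul]

theorem mul_mul_kpP (y : G.KPAlgebra F) (v : V) :
    G.kpP F v * (G.kpP F v * y) = G.kpP F v * y := by
  rw [← mul_assoc, (G.kp_isKPFamily F).kp1_self]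

theorem subsingleton_pathsInto {v : V} [G.NoSources] (h : Subsingleton (G.InfPath v))
    (n : Fin k → ℕ) : Subsingleton (G.PathsInto v n) := by
  refine ⟨fun α β => ?_⟩
  obtain ⟨x⟩ : Nonempty (G.InfPath α.source) := inferInstance
  obtain ⟨y⟩ : Nonempty (G.InfPath β.source) := inferInstance
  have h1 := congrArg (fun z : G.InfPath v => z.seg n)
    (Subsingleton.elim (x.prepend α.hom) (y.prepend β.hom))
  simp only [x.seg_prepend_self α.hom α.deg_hom, y.seg_prepend_self β.hom β.deg_hom] at h1
  exact h1

theorem subsingleton_infPath {G : HigherRankGraph k V} {v : V}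
    (h : ∀ n, Subsingleton (G.PathsInto v n)) : Subsingleton (G.InfPath v) :=
  ⟨fun _ _ => InfPath.ext (funext fun n => (h n).elim _ _)⟩

/-- With one infinite path into `v`, `p_v` projects onto a free module of rank one, so its corner
acts through Laurent polynomials. -/
theorem repP_eq_smul_delta {v : V} [Subsingleton (G.InfPath v)] (x : G.InfPath v)
    (g : G.PathModule F) : rep G F (G.kpP F v) g = g ⟨v, x⟩ • delta F ⟨v, x⟩ := by
  rw [rep_P, repP_apply]
  funext y
  by_cases h : ∃ z, concat (𝟙 v) z = y
  · obtain ⟨z, rfl⟩ := h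
    rw [Subsingleton.elim z x, push_apply, pull_apply, concat_id, Pi.smul_apply, delta_self,
      smul_eq_mul, mul_one]
  · push Not at h
    rw [push_apply_of_notMem _ _ h, Pi.smul_apply, delta_ne, smul_zero]
    rw [← concat_id]
    exact (h x).symm

theorem exists_rep_eq_smul_delta {v : V} [Subsingleton (G.InfPath v)] (x : G.InfPath v)
    {z : G.KPAlgebra F} (hz : G.kpP F v * z = z) (g : G.PathModule F) :
    ∃ q : 𝓛, rep G F z g = q • delta F ⟨v, x⟩ := by
  rw [← hz, map_mul, Module.End.mul_apply, repP_eq_smul_delta x]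
  exact ⟨_, rfl⟩

/-- Given two infinite paths `x`, `x'`, a range projection separating `p x` from `p x'` leaves the
generator nonzero at `x` but kills it at `x'`. By minimality the generator is a left multiple of
this product, so it would vanish at `x'`, where it acts by a nonzero scalar. -/
theorem subsingleton_of_isMinimalGenerator {a : V} {c : (Σ b : V, (a ⟶ b)) →₀ F} (hc : c ≠ 0)
    (hred : ∀ x : G.InfPath a, ∀ p ∈ c.support, ∀ q ∈ c.support, concat p.2 x = concat q.2 x)
    (h : IsMinimalGenerator (pathSum G F a c)) : Subsingleton (G.InfPath a) := by
  refine ⟨fun x x' => ?_⟩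
  by_contra hne
  obtain ⟨p, hp⟩ := Finsupp.support_nonempty_iff.2 hc
  obtain ⟨d, b, η, ⟨z, hz⟩, hη⟩ := exists_separating ((concat_injective p.2).ne hne)
  obtain ⟨q, hq, h1⟩ := rep_reduced_pathSum (x := x) hc fun s hs => hred x s hs p hp
  obtain ⟨q', hq', h2⟩ := rep_reduced_pathSum (x := x') hc fun s hs => hred x' s hs p hp
  have h3 : G.kpS F η * G.kpSg F η * pathSum G F a c ≠ 0 := by
    intro h0
    have h4 := congrArg (fun y => rep G F y (delta F ⟨a, x⟩)) h0
    simp only [map_mul _ (_ * _), Module.End.mul_apply, h1, map_smul, map_zero] at h4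
    rw [← hz, rep_projection_delta, LinearMap.zero_apply] at h4
    exact smul_delta_ne_zero hq _ h4
  obtain ⟨b, hb⟩ := h.2 _ h3
  have h4 := congrArg (fun y => rep G F y (delta F ⟨a, x'⟩)) hb
  simp only [map_mul _ b, map_mul _ (_ * _), Module.End.mul_apply, h2, map_smul] at h4
  rw [rep_projection_delta_of_ne η hη, map_zero, smul_zero] at h4
  exact smul_delta_ne_zero hq' _ h4.symm

variable [G.NoSources]

theorem eq_of_rep_delta_eq {v : V} [Subsingleton (G.InfPath v)] {x : G.InfPath v}
    {y z : G.KPAlgebra F} (hy : y * G.kpP F v = y) (hz : z * G.kpP F v = z)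
    (h : rep G F y (delta F ⟨v, x⟩) = rep G F z (delta F ⟨v, x⟩)) : y = z := by
  refine sub_eq_zero.1 (rep_injective (F := F) ?_)
  rw [map_sub, sub_eq_zero]
  ext1 g
  rw [← hy, ← hz, map_mul, map_mul, Module.End.mul_apply, Module.End.mul_apply,
    repP_eq_smul_delta x, map_smul, map_smul, h]

/-- In the corner of a vertex that receives only one infinite path, a minimal generator is left
invertible. -/
theorem exists_mul_eq_kpP {v : V} [Subsingleton (G.InfPath v)] {x : G.InfPath v}
    {z : G.KPAlgebra F} (hz : IsMinimalGenerator z) (hl : G.kpP F v * z = z)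
    (hr : z * G.kpP F v = z) : ∃ b, b * z = G.kpP F v := by
  have h := G.kp_isKPFamily F
  obtain ⟨q, hq⟩ := exists_rep_eq_smul_delta x hl (delta F ⟨v, x⟩)
  have hq0 : q ≠ 0 := by
    rintro rfl
    rw [zero_smul] at hq
    refine hz.1 (eq_of_rep_delta_eq hr (zero_mul _) (x := x) ?_)
    rw [hq, map_zero, LinearMap.zero_apply]
  have hzz : rep G F (z * z) (delta F ⟨v, x⟩) = (q * q) • delta F ⟨v, x⟩ := by
    rw [map_mul, Module.End.mul_apply, hq, map_smul, hq, smul_smul]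
  have hzz0 : z * z ≠ 0 := fun h0 => by
    rw [h0, map_zero, LinearMap.zero_apply] at hzz
    exact smul_delta_ne_zero (mul_ne_zero hq0 hq0) _ hzz.symm
  -- If `z` acts by `q`, then `z * z` acts by `q * q`, nonzero in a domain. Minimality returns `z`
  -- from `z * z`, and cancelling `q` shows that `b` inverts it.
  obtain ⟨b, hb⟩ := hz.2 z hzz0
  have hb' : G.kpP F v * b * (z * z) = z := by rw [mul_assoc, hb, hl]
  obtain ⟨r, hr'⟩ := exists_rep_eq_smul_delta (z := G.kpP F v * b) x (mul_mul_kpP b v)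
    (delta F ⟨v, x⟩)
  have h1 := congrArg (fun y => rep G F y (delta F ⟨v, x⟩)) hb'
  simp only [map_mul _ (_ * b), Module.End.mul_apply, hzz, map_smul, hr', hq, smul_smul] at h1
  have h2 := congrFun h1 ⟨v, x⟩
  rw [Pi.smul_apply, Pi.smul_apply, delta_self, smul_eq_mul, smul_eq_mul, mul_one, mul_one] at h2
  have h3 : q * r = 1 := mul_left_cancel₀ hq0 (by rw [← mul_assoc, h2, mul_one])
  refine ⟨G.kpP F v * b, eq_of_rep_delta_eq (x := x) ?_ (h.kp1_self v) ?_⟩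
  · rw [mul_assoc, hr]
  · rw [map_mul, Module.End.mul_apply, hq, map_smul, hr', smul_smul, h3, one_smul, rep_P_delta]

/-- Reduce `y` to a path combination that is still a minimal generator. Its source then receives a
single infinite path, and a ghost path brings the combination into that corner, where it is left
invertible. -/
theorem exists_kpP_of_isMinimalGenerator {y : G.KPAlgebra F} (hy : IsMinimalGenerator y) :
    ∃ v, IsMinimalGenerator (G.kpP F v) ∧ ∃ a b, a * y * b = G.kpP F v := by
  have h := G.kp_isKPFamily F
  obtain ⟨v, c, hc, ⟨h1, a, b, h2⟩, hred⟩ := exists_reduced_pathSum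
    (Q := fun z : G.KPAlgebra F => IsMinimalGenerator z ∧ ∃ a b, z = a * y * b)
    (by
      rintro a _ ⟨h1, a', b', rfl⟩ h2
      exact ⟨h1.mul_left h2, a * a', b', by simp only [mul_assoc]⟩)
    (by
      rintro _ b ⟨h1, a', b', rfl⟩ h2
      exact ⟨h1.mul_right h2, a', b' * b, by simp only [mul_assoc]⟩) hy.1
    ⟨hy, by
      obtain ⟨e, he⟩ := exists_left_unit y
      obtain ⟨f, hf⟩ := exists_right_unit y
      exact ⟨e, f, by rw [he, hf]⟩⟩
  have hs := subsingleton_of_isMinimalGenerator hc hred h1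
  obtain ⟨x⟩ : Nonempty (G.InfPath v) := inferInstance
  obtain ⟨p, hp⟩ := Finsupp.support_nonempty_iff.2 hc
  obtain ⟨q, hq, h3⟩ := rep_reduced_pathSum (x := x) hc fun s hs => hred x s hs p hp
  have hz : G.kpSg F p.2 * pathSum G F v c ≠ 0 := by
    intro h0
    have h4 := congrArg (fun y => rep G F y (delta F ⟨v, x⟩)) h0
    simp only [map_mul, Module.End.mul_apply, h3, map_smul, rep_Sg, map_zero] at h4
    rw [repSg_delta, smul_smul, LinearMap.zero_apply] at h4
    exact smul_delta_ne_zero (mul_ne_zero hq (weight_ne_zero _)) _ h4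
  have hr : pathSum G F v c * G.kpP F v = pathSum G F v c := by
    rw [pathSum, Finsupp.linearCombination_apply, Finsupp.sum, Finset.sum_mul]
    exact Finset.sum_congr rfl fun s _ => by rw [smul_mul_assoc, h.kp2_path_source]
  obtain ⟨b', hb'⟩ := exists_mul_eq_kpP (x := x) (h1.mul_left hz)
    (by rw [← mul_assoc, h.kp2_source_ghost]) (by rw [mul_assoc, hr])
  refine ⟨v, ?_, b' * G.kpSg F p.2 * a, b, ?_⟩
  · rw [← hb']
    refine (h1.mul_left hz).mul_left ?_
    rw [hb']
    exact kpP_ne_zero v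
  · rw [← hb', h2]
    simp only [mul_assoc]

end Minimal

/-! ### Minimal vertices, the socle, and essentiality -/

section Main

variable {G : HigherRankGraph k V} [G.RowFinite] {F : Type x} [Field F]

local notation "𝓛" => AddMonoidAlgebra F (Fin k → ℤ)

theorem subsingleton_of_isMinimalGenerator_kpP {v : V} (h : IsMinimalGenerator (G.kpP F v)) :
    Subsingleton (G.InfPath v) := by
  have h1 : pathSum G F v (Finsupp.single ⟨v, 𝟙 v⟩ 1) = G.kpP F v := by
    rw [pathSum_single, one_smul, (G.kp_isKPFamily F).S_id]
  refine subsingleton_of_isMinimalGenerator (c := Finsupp.single ⟨v, 𝟙 v⟩ (1 : F))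
    (by simp) (fun x p hp q hq => ?_) (h1 ▸ h)
  rw [Finset.mem_singleton.1 (Finsupp.support_single_subset hp),
    Finset.mem_singleton.1 (Finsupp.support_single_subset hq)]

theorem kpP_mem_kpIdeal {H : Set V} {v : V} (hv : v ∈ H) : G.kpP F v ∈ G.kpIdeal F H :=
  TwoSidedIdeal.subset_span ⟨v, hv, rfl⟩

theorem exists_path_of_mul_mul_ne_zero {v w : V} {t : G.KPAlgebra F}
    (h : G.kpP F v * t * G.kpP F w ≠ 0) : ∃ a : V, Nonempty (a ⟶ v) ∧ Nonempty (a ⟶ w) := by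
  have hf := G.kp_isKPFamily F
  by_contra! hc
  refine h ?_
  induction t using kp_span_induction with
  | @mem a b c la mu =>
    by_cases hb : v = b
    · by_cases hc' : c = w
      · subst hb hc'
        exact ((hc a ⟨la⟩).false mu).elim
      · rw [mul_assoc, mul_assoc (G.kpS F la), mul_kpP_ne hc' (hf.kp2_ghost_range mu), mul_zero,
          mul_zero]
    · rw [← mul_assoc, kpP_mul_ne hb (hf.kp2_range_path la), zero_mul, zero_mul]
  | zero => rw [mul_zero, zero_mul]
  | add y z h1 h2 =>
    rw [mul_add, add_mul]
    by_contra h3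
    by_cases h4 : G.kpP F v * y * G.kpP F w = 0
    · rw [h4, zero_add] at h3
      exact h3 (h2 h3)
    · exact h4 (h1 h4)
  | smul r y h1 =>
    rw [mul_smul_comm, smul_mul_assoc]
    by_contra h3
    by_cases h4 : G.kpP F v * y * G.kpP F w = 0
    · exact h3 (by rw [h4, smul_zero])
    · exact h4 (h1 h4)

variable [G.NoSources]

/-- The augmentation, sending every monomial to `1`, kills `1 - t^n`. -/
theorem eq_zero_of_mul_one_sub_weight_eq_one {n : Fin k → ℤ} {q : 𝓛}
    (h : q * (1 - weight F n) = 1) : False := by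
  let ε : 𝓛 →ₐ[F] F := AddMonoidAlgebra.lift F F (Fin k → ℤ) 1
  have h1 : ε (weight F n) = 1 := by
    simp [ε, weight, AddMonoidAlgebra.lift_single]
  have h2 := congrArg ε h
  rw [map_mul, map_sub, map_one, h1, sub_self, mul_zero] at h2
  exact zero_ne_one h2

/-- On the only infinite path into `v`, `p_v - s_la s_{mu*}` acts by `1 - t^(d(la) - d(mu))`. If the
degrees differ this is nonzero, so minimality would force it to be invertible. -/
theorem deg_eq_of_isMinimalGenerator_kpP {v a : V} (h : IsMinimalGenerator (G.kpP F v))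
    (la mu : a ⟶ v) : G.deg la = G.deg mu := by
  have hf := G.kp_isKPFamily F
  have hs := subsingleton_of_isMinimalGenerator_kpP h
  obtain ⟨x⟩ : Nonempty (G.InfPath a) := inferInstance
  by_contra hne
  have hx : concat la x = concat mu x := by
    rw [concat, concat, Subsingleton.elim (x.prepend la) (x.prepend mu)]
  have h1 : rep G F (G.kpS F la * G.kpSg F mu) (delta F (concat mu x)) =
      weight F (G.degZ la - G.degZ mu) • delta F (concat mu x) := by
    rw [map_mul, Module.End.mul_apply, rep_Sg, repSg_delta, map_smul, rep_S_delta, hx, smul_smul,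
      weight_add, neg_add_eq_sub]
  have hr : G.kpS F la * G.kpSg F mu * G.kpP F v = G.kpS F la * G.kpSg F mu := by
    rw [mul_assoc, hf.kp2_ghost_range]
  have hz : rep G F (G.kpP F v - G.kpS F la * G.kpSg F mu) (delta F (concat mu x)) =
      (1 - weight F (G.degZ la - G.degZ mu)) • delta F (concat mu x) := by
    have h2 : rep G F (G.kpP F v - G.kpS F la * G.kpSg F mu) =
        rep G F (G.kpP F v) - rep G F (G.kpS F la * G.kpSg F mu) := map_sub (rep G F) _ _
    rw [h2, LinearMap.sub_apply, h1, sub_smul, one_smul]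
    congr 1
    exact rep_P_delta _
  have hw : (1 - weight F (G.degZ la - G.degZ mu)) ≠ 0 := by
    rw [sub_ne_zero, ← weight_zero]
    intro h0
    have h2 := AddMonoidAlgebra.single_left_injective (one_ne_zero (α := F)) h0
    exact hne (degZ_injective.1 (sub_eq_zero.1 h2.symm))
  have hz0 : G.kpP F v - G.kpS F la * G.kpSg F mu ≠ 0 := fun h0 => by
    rw [h0, map_zero, LinearMap.zero_apply] at hz
    exact smul_delta_ne_zero hw _ hz.symm
  have hr' : (G.kpP F v - G.kpS F la * G.kpSg F mu) * G.kpP F v =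
      G.kpP F v - G.kpS F la * G.kpSg F mu := by
    rw [sub_mul (G.kpP F v), hf.kp1_self, hr]
  obtain ⟨b, hb⟩ := h.2 (G.kpP F v - G.kpS F la * G.kpSg F mu) (by rwa [hr'])
  rw [hr'] at hb
  obtain ⟨q, hq⟩ := exists_rep_eq_smul_delta (z := G.kpP F v * b) (x.prepend mu)
    (mul_mul_kpP b v) (delta F (concat mu x))
  have hb' : G.kpP F v * b * (G.kpP F v - G.kpS F la * G.kpSg F mu) = G.kpP F v := by
    rw [mul_assoc, hb, hf.kp1_self]
  have h2 := congrArg (fun y => rep G F y (delta F (concat mu x))) hb'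
  simp only [map_mul _ (_ * b), Module.End.mul_apply, hz, map_smul, hq, smul_smul] at h2
  have h3 := congrFun (h2.trans (rep_P_delta (x.prepend mu))) (concat mu x)
  change ((1 - weight F (G.degZ la - G.degZ mu)) * q) • delta F (concat mu x) (concat mu x) =
    delta F (concat mu x) (concat mu x) at h3
  rw [delta_self, smul_eq_mul, mul_one, mul_comm] at h3
  exact eq_zero_of_mul_one_sub_weight_eq_one h3

/-- Extend `la` and `mu` along `x` to their common degree `d(la) ⊔ d(mu)`. The results agree, so the
two extensions are paths into `a` with one source and have equal degree; then `d(la) = d(mu)` and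
factorization is unique. -/
theorem eq_of_concat_eq_of_isAperiodicAtom {a : V} (ha : IsAperiodicAtom (G.state a 0))
    {p q : Σ b : V, (a ⟶ b)} {x : G.InfPath a} (h : concat p.2 x = concat q.2 x) : p = q := by
  obtain ⟨b, la⟩ := p
  obtain ⟨b', mu⟩ := q
  obtain ⟨h1, h2⟩ := Sigma.mk.inj_iff.1 h
  change b = b' at h1
  subst h1
  have h3 : x.prepend la = x.prepend mu := eq_of_heq h2
  have h4 := congrArg (fun z : G.InfPath b => (z.seg (G.deg la ⊔ G.deg mu)).1) h3
  obtain ⟨m, hm⟩ := exists_add_of_le (le_sup_left : G.deg la ≤ G.deg la ⊔ G.deg mu)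
  obtain ⟨n, hn⟩ := exists_add_of_le (le_sup_right : G.deg mu ≤ G.deg la ⊔ G.deg mu)
  have h5 : (⟨(x.seg m).source, (x.seg m).hom ≫ la⟩ : Σ c : V, (c ⟶ b)) =
      ⟨(x.seg n).source, (x.seg n).hom ≫ mu⟩ := by
    rw [← x.seg_prepend, ← x.seg_prepend, ← hm, ← hn]
    exact h4
  have h6 : ∀ {c d : V} (ξ : c ⟶ a) (ζ : d ⟶ a),
      (⟨c, ξ ≫ la⟩ : Σ c : V, (c ⟶ b)) = ⟨d, ζ ≫ mu⟩ → la = mu := by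
    intro c d ξ ζ h
    obtain ⟨h7, h8⟩ := Sigma.mk.inj_iff.1 h
    subst h7
    have h9 := ((isAperiodicAtom_state_iff a).1 ha).2 _ ξ ζ
    have h10 := congrArg G.deg (eq_of_heq h8)
    rw [G.deg_comp, G.deg_comp, h9] at h10
    have h11 := G.factor_unique (eq_of_heq h8) (add_right_cancel h10)
    obtain ⟨-, h12⟩ := Sigma.mk.inj_iff.1 h11
    exact (Prod.ext_iff.1 (eq_of_heq h12)).2
  rw [h6 _ _ h5]

theorem isMinimalGenerator_kpP_of_isAperiodicAtom {v : V} (hv : IsAperiodicAtom (G.state v 0)) :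
    IsMinimalGenerator (G.kpP F v) := by
  have h := G.kp_isKPFamily F
  have hsub := ((isAperiodicAtom_state_iff v).1 hv).1
  refine ⟨kpP_ne_zero v, fun a ha => ?_⟩
  obtain ⟨u, hu⟩ := exists_mul_path_ne_zero ha
  obtain ⟨n, hn⟩ := exists_degree_mul_path_eq_pathSum (a * G.kpP F v)
  obtain ⟨μ, hμ⟩ := hu n
  obtain ⟨c, hc⟩ := hn n le_rfl μ.hom μ.deg_hom
  obtain rfl : u = v := by
    by_contra hne
    rw [mul_assoc, kpP_mul_ne (Ne.symm hne) (h.kp2_range_path μ.hom), mul_zero] at hμ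
    exact hμ rfl
  have hw := isAperiodicAtom_source hv μ.hom
  have := subsingleton_infPath ((isAperiodicAtom_state_iff μ.source).1 hw).1
  obtain ⟨x⟩ : Nonempty (G.InfPath μ.source) := inferInstance
  have hc0 : c ≠ 0 := by
    rintro rfl
    exact hμ (hc.trans (map_zero _))
  obtain ⟨p, hp⟩ := Finsupp.support_nonempty_iff.2 hc0
  -- The other paths in the support send `x` elsewhere, so the ghost of `p` kills their terms; the
  -- comparison at `x` alone suffices because the source of `μ` receives one infinite path.
  have h1 : G.kpSg F p.2 * (a * G.kpP F u * G.kpS F μ.hom) = c p • G.kpP F μ.source := by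
    refine eq_of_rep_delta_eq (x := x) ?_ ?_ ?_
    · rw [mul_assoc, mul_assoc (a * G.kpP F u), h.kp2_path_source]
    · rw [smul_mul_assoc, h.kp1_self]
    · have hF : ∀ (r : F) (T : Module.End 𝓛 (G.PathModule F)) (g : G.PathModule F),
          T (r • g) = r • T g := fun r T g => LinearMap.map_smul_of_tower T r g
      rw [hc, map_mul, Module.End.mul_apply, rep_pathSum_delta, Finsupp.sum, map_sum,
        Finset.sum_eq_single p, hF, map_smul (rep G F), LinearMap.smul_apply, rep_P_delta,
        map_smul, rep_Sg, repSg_delta, smul_smul, weight_add, add_neg_cancel, weight_zero, one_smul]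
      · intro s _ hs
        rw [hF, map_smul, rep_Sg, repSg_delta_of_ne, smul_zero, smul_zero]
        intro z hz
        rw [Subsingleton.elim z x] at hz
        exact hs (eq_of_concat_eq_of_isAperiodicAtom hw hz).symm
      · exact fun h2 => absurd hp h2
  have h2 : G.kpS F μ.hom * G.kpSg F μ.hom = G.kpP F u := by
    have := hsub n
    rw [h.kp4 u n, Fintype.sum_subsingleton _ μ]
  refine ⟨(c p)⁻¹ • (G.kpS F μ.hom * G.kpSg F p.2), ?_⟩
  have h3 : a * G.kpP F u = a * G.kpP F u * G.kpS F μ.hom * G.kpSg F μ.hom := by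
    rw [mul_assoc (a * G.kpP F u), h2, mul_assoc, h.kp1_self]
  rw [h3, smul_mul_assoc, mul_assoc, ← mul_assoc (G.kpSg F p.2), h1, smul_mul_assoc,
    mul_smul_comm, smul_smul, inv_mul_cancel₀ (Finsupp.mem_support_iff.1 hp), one_smul,
    h.kp2_source_ghost, h2]

theorem isMinimalGenerator_kpP_iff (v : V) :
    IsMinimalGenerator (G.kpP F v) ↔ IsAperiodicAtom (G.state v 0) := by
  refine ⟨fun h => (isAperiodicAtom_state_iff v).2 ⟨?_, ?_⟩,
    isMinimalGenerator_kpP_of_isAperiodicAtom⟩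
  · exact subsingleton_pathsInto (subsingleton_of_isMinimalGenerator_kpP h)
  · exact fun a la mu => deg_eq_of_isMinimalGenerator_kpP h la mu

variable (G) in
/-- The vertices of the `ℤ^k`-order ideal generated by the aperiodic atoms. -/
abbrev atomicVertices : Set V :=
  vertexSet (orderIdealSpan {a : G.TalentedMonoid | IsAperiodicAtom a})

theorem mem_atomicVertices_of_isAperiodicAtom {v : V} (hv : IsAperiodicAtom (G.state v 0)) :
    v ∈ G.atomicVertices :=
  (mem_vertexSet_aperiodicAtom_iff v).2 ⟨0, fun α => isAperiodicAtom_source hv α.hom⟩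

/-- By `kp4`, `p_v` is a sum of `s_α s_{α*}` with atomic sources, and `s_{α*} = p_{s(α)} s_{α*}` is
a right multiple of a minimal generator. -/
theorem kpP_mem_leftSocle {v : V} (hv : v ∈ G.atomicVertices) :
    G.kpP F v ∈ leftSocle (G.KPAlgebra F) := by
  have h := G.kp_isKPFamily F
  obtain ⟨n, hn⟩ := (mem_vertexSet_aperiodicAtom_iff v).1 hv
  rw [h.kp4 v n]
  refine sum_mem fun α _ => ?_
  have h1 : G.kpP F α.source * G.kpSg F α.hom ≠ 0 := by
    intro h0
    rw [h.kp2_source_ghost] at h0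
    have h2 := h.kp3_self α.hom
    rw [h0, zero_mul] at h2
    exact kpP_ne_zero _ h2.symm
  have h2 := ((isMinimalGenerator_kpP_iff (F := F) α.source).2 (hn α)).mul_right h1
  rw [h.kp2_source_ghost] at h2
  exact (le_sSup ((isMinimalLeftIdeal_leftMultiples_iff exists_left_unit _).2 h2) :
    _ ≤ leftSocle (G.KPAlgebra F)) ⟨_, rfl⟩

theorem mem_leftSocle_iff (y : G.KPAlgebra F) :
    y ∈ leftSocle (G.KPAlgebra F) ↔ y ∈ G.kpIdeal F G.atomicVertices := by
  constructor
  · intro hy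
    let I : AddSubgroup (G.KPAlgebra F) :=
      { carrier := {y | y ∈ G.kpIdeal F G.atomicVertices}
        zero_mem' := (G.kpIdeal F G.atomicVertices).zero_mem
        add_mem' := (G.kpIdeal F G.atomicVertices).add_mem
        neg_mem' := (G.kpIdeal F G.atomicVertices).neg_mem }
    have hle : leftSocle (G.KPAlgebra F) ≤ I := by
      refine sSup_le fun L hL => ?_
      obtain ⟨l, hl, hl0⟩ := L.bot_or_exists_ne_zero.resolve_left hL.2.1
      have h1 := hL.eq_leftMultiples exists_left_unit hl hl0
      have h2 : IsMinimalGenerator l :=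
        (isMinimalLeftIdeal_leftMultiples_iff exists_left_unit l).1 (h1 ▸ hL)
      obtain ⟨v, hv, a, b, hab⟩ := exists_kpP_of_isMinimalGenerator h2
      have hv' := (isMinimalGenerator_kpP_iff v).1 hv
      have h3 : G.kpP F v * (a * l) ∈ L := hL.1 _ _ (hL.1 _ _ hl)
      have h4 : G.kpP F v * (a * l) ≠ 0 := by
        intro h0
        apply kpP_ne_zero (G := G) (F := F) v
        rw [← (G.kp_isKPFamily F).kp1_self v]
        conv_lhs => arg 2; rw [← hab]
        rw [← mul_assoc, h0, zero_mul]
      -- The nonzero element `p_v (a l)` generates all of `L`, and it lies in the ideal of `p_v`.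
      rw [← hL.eq_leftMultiples exists_left_unit h3 h4]
      rintro _ ⟨c, rfl⟩
      exact TwoSidedIdeal.mul_mem_left _ _ _ (TwoSidedIdeal.mul_mem_right _ _ _
        (kpP_mem_kpIdeal (G := G) (mem_atomicVertices_of_isAperiodicAtom hv')))
    exact hle hy
  · intro hy
    have hle : G.kpIdeal F G.atomicVertices ≤
        leftSocleIdeal (A := G.KPAlgebra F) exists_left_unit := by
      refine TwoSidedIdeal.span_le.2 ?_
      rintro _ ⟨v, hv, rfl⟩
      exact (mem_leftSocleIdeal exists_left_unit).2 (kpP_mem_leftSocle hv)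
    exact (mem_leftSocleIdeal exists_left_unit).1 (hle hy)

/-- Nonzero two-sided ideals of the Kumjian-Pask algebra have nonzero squares. -/
theorem exists_mul_self_ne_zero (I : TwoSidedIdeal (G.KPAlgebra F)) (hI : I ≠ ⊥) :
    ∃ z ∈ I, z * z ≠ 0 := by
  obtain ⟨y, hy, hy0⟩ := I.exists_ne_zero_of_ne_bot hI
  obtain ⟨v, c, hc, h1, hred⟩ := exists_reduced_pathSum (Q := fun z => z ∈ I)
    (fun a z hz _ => I.mul_mem_left a z hz) (fun z b hz _ => I.mul_mem_right z b hz) hy0 hy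
  obtain ⟨x⟩ : Nonempty (G.InfPath v) := inferInstance
  obtain ⟨p, hp⟩ := Finsupp.support_nonempty_iff.2 hc
  obtain ⟨q, hq, h3⟩ := rep_reduced_pathSum (x := x) hc fun s hs => hred x s hs p hp
  refine ⟨G.kpSg F p.2 * pathSum G F v c, I.mul_mem_left _ _ h1, fun h0 => ?_⟩
  have h2 : rep G F (G.kpSg F p.2 * pathSum G F v c) (delta F ⟨v, x⟩) =
      (q * weight F (-G.degZ p.2)) • delta F ⟨v, x⟩ := by
    rw [map_mul, Module.End.mul_apply, h3, map_smul, rep_Sg, repSg_delta, smul_smul]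
  have h4 := congrArg (fun y => rep G F y (delta F ⟨v, x⟩)) h0
  simp only [map_mul _ (G.kpSg F p.2 * _), Module.End.mul_apply, h2, map_smul, smul_smul,
    map_zero] at h4
  exact smul_delta_ne_zero (mul_ne_zero (mul_ne_zero hq (weight_ne_zero _))
    (mul_ne_zero hq (weight_ne_zero _))) _ h4

/-- Extend `mu` by a path of degree `n`: the whole passes through the source of an initial segment
of degree `n`, which is an atom, and sources of paths into an atom are atoms. -/
theorem exists_isAperiodicAtom_of_mem_atomicVertices {w a : V} (hw : w ∈ G.atomicVertices)
    (mu : a ⟶ w) : ∃ (b : V) (_ : b ⟶ a), IsAperiodicAtom (G.state b 0) := by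
  obtain ⟨n, hn⟩ := (mem_vertexSet_aperiodicAtom_iff w).1 hw
  obtain ⟨τ⟩ := NoSources.nonempty_pathsInto (G := G) a n
  obtain ⟨c, ξ, α, h1, h2, -⟩ := G.exists_factor_of_le (τ.hom ≫ mu) (m := n) (by
    rw [G.deg_comp, τ.deg_hom]; exact le_add_self)
  exact ⟨τ.source, τ.hom, isAperiodicAtom_source (hn (G.toPathsInto α h2)) ξ⟩

theorem isEssentialIdeal_leftSocle_iff :
    IsEssentialIdeal (leftSocle (G.KPAlgebra F)) ↔
      ∀ v : V, ∃ (a : V) (_ : a ⟶ v), IsAperiodicAtom (G.state a 0) := by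
  have hf := G.kp_isKPFamily F
  constructor
  · rintro ⟨I, hI, hess⟩ v
    have hJ : G.kpIdeal F {v} ≠ ⊥ := by
      intro h
      have h1 := kpP_mem_kpIdeal (G := G) (F := F) (Set.mem_singleton v)
      rw [h, TwoSidedIdeal.mem_bot] at h1
      exact kpP_ne_zero v h1
    obtain ⟨z, hz, hzz⟩ := exists_mul_self_ne_zero _ (hess _ hJ)
    obtain ⟨hz1, hz2⟩ := (TwoSidedIdeal.mem_inf _).1 hz
    have hz3 : z ∈ G.kpIdeal F G.atomicVertices :=
      (mem_leftSocle_iff z).1 (hI ▸ hz1 : z ∈ (leftSocle (G.KPAlgebra F) : Set (G.KPAlgebra F)))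
    -- If all these products vanished, so would the product of the ideals of `v` and of the atomic
    -- vertices; but `z` lies in both and `z * z ≠ 0`.
    obtain ⟨w, hw, t, ht⟩ : ∃ w ∈ G.atomicVertices, ∃ t, G.kpP F v * t * G.kpP F w ≠ 0 := by
      by_contra! hc
      obtain ⟨e, he⟩ := exists_left_unit z
      have h1 : z * e * z = 0 := by
        refine TwoSidedIdeal.mul_mul_eq_zero_of_mem_span ?_ hz2 hz3 e
        rintro _ ⟨v', rfl, rfl⟩ _ ⟨w, hw, rfl⟩ t
        exact hc w hw t
      rw [mul_assoc, he] at h1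
      exact hzz h1
    obtain ⟨a, ⟨la⟩, ⟨mu⟩⟩ := exists_path_of_mul_mul_ne_zero ht
    obtain ⟨b, ξ, hb⟩ := exists_isAperiodicAtom_of_mem_atomicVertices hw mu
    exact ⟨b, ξ ≫ la, hb⟩
  · intro h
    refine ⟨G.kpIdeal F G.atomicVertices, Set.ext fun y => (mem_leftSocle_iff y).symm,
      fun J hJ hbot => ?_⟩
    obtain ⟨y, hy, hy0⟩ := J.exists_ne_zero_of_ne_bot hJ
    obtain ⟨a, v, mu, c, h1, h2⟩ := exists_mul_path_eq_pathSum hy0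
    obtain ⟨b, ν, hb⟩ := h a
    -- The factor `s_ν` puts the product in the socle. It cannot vanish, since composing with `ν` is
    -- injective on paths and so loses no coefficient.
    have hy1 : y * G.kpS F mu * G.kpS F ν ∈ G.kpIdeal F G.atomicVertices ⊓ J := by
      refine (TwoSidedIdeal.mem_inf _).2 ⟨?_, J.mul_mem_right _ _ (J.mul_mem_right _ _ hy)⟩
      rw [← hf.kp2_path_source ν]
      exact TwoSidedIdeal.mul_mem_left _ _ _ (TwoSidedIdeal.mul_mem_left _ _ _
        (kpP_mem_kpIdeal (G := G) (mem_atomicVertices_of_isAperiodicAtom hb)))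
    rw [hbot, TwoSidedIdeal.mem_bot, h1, pathSum_mul_path] at hy1
    obtain ⟨x⟩ : Nonempty (G.InfPath b) := inferInstance
    have h3 := pathSum_rep_injective x (by rw [hy1, map_zero, LinearMap.zero_apply])
    have h4 := Finsupp.mapDomain_injective (comp_path_injective G ν)
      (h3.trans Finsupp.mapDomain_zero.symm)
    rw [h1, h4, map_zero] at h2
    exact h2 rfl

end Main
end HigherRankGraph

theorem mainTheorem9 {k : ℕ} (hk : 0 < k) {V : Type u} [Category.{w} V]
    (Λ : HigherRankGraph k V) [Λ.RowFinite] [Λ.NoSources] (F : Type x) [Field F] :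
    (∀ v : V, IsMinimalLeftIdeal (leftMultiples (Λ.kpP F v)) ↔
      HigherRankGraph.IsAperiodicAtom (Λ.state v 0)) ∧
    (leftSocle (Λ.KPAlgebra F) : Set (Λ.KPAlgebra F)) =
      (Λ.kpIdeal F (HigherRankGraph.vertexSet (HigherRankGraph.orderIdealSpan
        {a : Λ.TalentedMonoid | HigherRankGraph.IsAperiodicAtom a})) :
          Set (Λ.KPAlgebra F)) ∧
    (IsEssentialIdeal (leftSocle (Λ.KPAlgebra F)) ↔
      ∀ v : V, ∃ (w : V) (m : Fin k → ℕ),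
        HigherRankGraph.AlgLE (Λ.state w (fun i => (m i : ℤ))) (Λ.state v 0) ∧
        HigherRankGraph.IsAperiodicAtom (Λ.state w (fun i => (m i : ℤ)))) := by
  refine ⟨fun v => ?_, Set.ext fun y => HigherRankGraph.mem_leftSocle_iff y, ?_⟩
  · exact (isMinimalLeftIdeal_leftMultiples_iff HigherRankGraph.exists_left_unit _).trans
      (HigherRankGraph.isMinimalGenerator_kpP_iff v)
  · exact HigherRankGraph.isEssentialIdeal_leftSocle_iff.trans
      (forall_congr' fun v => (HigherRankGraph.exists_aperiodicAtom_algLE_iff v).symm)
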